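/- Let $T$ be an injective bounded operator on a complex Hilbert space $\mathcal H$ that is half-centered, i.e. the operators $T_k := T^{*k}T^k$, $k\in\mathbb N=\{0,1,2,\dots\}$, commute with one another. Put $\mathcal E=\ker T^*$, let $\mathcal M_{\mathcal E}$ be the smallest closed subspace of $\mathcal H$ that contains $\mathcal E$ and is invariant under all $T_k$, and assume that $\dim\mathcal E=1$ and $\bigvee_{k\ge 0}T^k\mathcal M_{\mathcal E}=\mathcal H$. Notation. For $n\in\mathbb N$ let $\mathcal H_n=\overline{T^n\mathcal H}$, and let $P$ be the orthogonal projection onto $\mathcal H_1=\mathcal E^{\perp}$. For an injective operator $R$ let $\mathbb M_R$ be the von Neumann algebra generated by the operators $R^{*k}R^k$, $k\in\mathbb N$, and let $\theta_R$ be the isometric factor in the polar decomposition $R=\theta_R(R^*R)^{1/2}$. For $m\in\mathbb N$ let $\theta_{T,m}=\theta_{T|\mathcal H_{m-1}}\cdots\theta_{T|\mathcal H_1}\theta_{T|\mathcal H_0}$ (so $\theta_{T,0}=I$), where $T|\mathcal H_j$ is the restriction of $T$ to $\mathcal H_j$ and $\theta_{T|\mathcal H_j}$ is extended by $0$ to $\mathcal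 H_j^\perp$. For an algebra $\mathbb M$ of operators and a subspace $V$ invariant under it, $\mathbb M|V$ is the algebra of restrictions to $V$ of elements of $\mathbb M$, and $\sigma(\mathbb M|V)$ is its Gelfand spectrum, the set of its characters. Let $\mathcal F$ be the set of all triples $(\lambda,\gamma,m)$ with $\lambda\in\sigma(\mathbb M_T|\mathcal M_{\mathcal E})$, $\gamma\in\sigma(\mathbb M_{T|\mathcal H_1}|\mathcal M_{\mathcal E}\ominus\mathcal E)$ and an integer $m\ge 1$ such that $$\gamma(PT_kP)=\lambda(\theta_{T,m}^*T_k\theta_{T,m})\qquad\text{for all }k\in\mathbb N,$$ where the operators are understood as restricted to $\mathcal M_{\mathcal E}\ominus\mathcal E$ and to $\mathcal M_{\mathcal E}$, respectively. Theorem. If $\mathcal F$ contains exactly one triple $(\lambda,\gamma,n)$, then there are an orthonormal basis $\{x_k : k\in\mathbb N\}$ of $\mathcal H$, a bounded weighted shift $J$ on this basis (i.e. $Jx_k=a_kx_{k+1}$ for all $k\in\mathbb N$, with nonzero $a_k\in\mathbb C$) and $a\in\mathbb C$ such that $$T=J+a\,(x_0\otimes x_{n-1}^*),$$ where $x_0\otimes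 x_{n-1}^*$ denotes the operator $x\mapsto\langle x,x_{n-1}\rangle x_0$. -/

import Mathlib

open scoped InnerProductSpace

noncomputable section

namespace HalfCentered

section Operators

variable {K : Type*} [NormedAddCommGroup K] [InnerProductSpace ℂ K] [CompleteSpace K]

/-- The operator `R_k = R^{*k} R^k`. -/
def gram (R : K →L[ℂ] K) (k : ℕ) : K →L[ℂ] K :=
  ContinuousLinearMap.adjoint (R ^ k) ∘L (R ^ k)

/-- `R` is half-centered: the operators `R^{*k} R^k` commute with one another. -/
def IsHalfCentered (R : K →L[ℂ] K) : Prop :=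
  ∀ j k : ℕ, Commute (gram R j) (gram R k)

/-- The subspace `E = ker R^* = (R K)^⊥`. -/
def kerAdj (R : K →L[ℂ] K) : Submodule ℂ K :=
  LinearMap.ker (ContinuousLinearMap.adjoint R : K →ₗ[ℂ] K)

/-- The von Neumann algebra generated by a set `S` of operators: the double commutant
of `S ∪ S^*`. -/
def vonNeumannGenerated (S : Set (K →L[ℂ] K)) : VonNeumannAlgebra K where
  toStarSubalgebra :=
    StarSubalgebra.centralizer ℂ (StarSubalgebra.centralizer ℂ S : Set (K →L[ℂ] K))
  centralizer_centralizer' := by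
    change Set.centralizer (Set.centralizer
      ((StarSubalgebra.centralizer ℂ (StarSubalgebra.centralizer ℂ S : Set (K →L[ℂ] K)) :
        StarSubalgebra ℂ (K →L[ℂ] K)) : Set (K →L[ℂ] K))) = (StarSubalgebra.centralizer ℂ
          (StarSubalgebra.centralizer ℂ S : Set (K →L[ℂ] K)) : Set (K →L[ℂ] K))
    rw [StarSubalgebra.coe_centralizer_centralizer, Set.centralizer_centralizer_centralizer]

/-- The von Neumann algebra `𝕄_R` generated by the operators `R_k`. -/
def gramAlgebra (R : K →L[ℂ] K) : VonNeumannAlgebra K :=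
  vonNeumannGenerated (Set.range (gram R))

/-- The algebra `𝒜|V` of operators on `V` that are restrictions to `V` of elements of `𝒜`. -/
def restrictedAlgebra (𝒜 : VonNeumannAlgebra K) (V : Submodule ℂ K) :
    Subalgebra ℂ (V →L[ℂ] V) where
  carrier := {b | ∃ a ∈ 𝒜, ∀ x : V, (b x : K) = a (x : K)}
  mul_mem' := by
    rintro b b' ⟨a, ha, hab⟩ ⟨a', ha', hab'⟩
    exact ⟨a * a', mul_mem ha ha', fun x => by simp [hab, hab']⟩
  add_mem' := by
    rintro b b' ⟨a, ha, hab⟩ ⟨a', ha', hab'⟩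
    exact ⟨a + a', add_mem ha ha', fun x => by simp [hab, hab']⟩
  algebraMap_mem' := fun c =>
    ⟨algebraMap ℂ (K →L[ℂ] K) c, 𝒜.toStarSubalgebra.algebraMap_mem c, fun x => by
      simp [Algebra.algebraMap_eq_smul_one]⟩

/-- The Gelfand spectrum `σ(𝒜|V)`: the characters (nonzero multiplicative linear functionals)
of `𝒜|V`. -/
abbrev restrictedSpectrum (𝒜 : VonNeumannAlgebra K) (V : Submodule ℂ K) : Type _ :=
  WeakDual.characterSpace ℂ (restrictedAlgebra 𝒜 V)

/-- The subspace `M_E`: the smallest closed subspace that contains `E = ker R^*` and is invariant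
under all the operators `R_k`. -/
def cyclicSubspace (R : K →L[ℂ] K) : Submodule ℂ K :=
  sInf {V : Submodule ℂ K | IsClosed (V : Set K) ∧ kerAdj R ≤ V ∧
    ∀ k : ℕ, ∀ x ∈ V, gram R k x ∈ V}

/-- The subspace `H_n`, the closure of the range of `R^n`. -/
def rangeClosure (R : K →L[ℂ] K) (n : ℕ) : Submodule ℂ K :=
  (LinearMap.range (R ^ n : K →L[ℂ] K).toLinearMap).topologicalClosure

instance (R : K →L[ℂ] K) (n : ℕ) : CompleteSpace (rangeClosure R n) :=
  (Submodule.isClosed_topologicalClosure _).completeSpace_coe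

set_option linter.unusedSectionVars false in
theorem map_mem_rangeClosure (R : K →L[ℂ] K) (n : ℕ) :
    ∀ x ∈ rangeClosure R n, R x ∈ rangeClosure R n := by
  intro x hx
  refine map_mem_closure R.continuous hx ?_
  rintro _ ⟨y, rfl⟩
  refine ⟨R y, ?_⟩
  change (R ^ n * R) y = (R * R ^ n) y
  rw [← pow_succ, ← pow_succ']

/-- The restriction `R|H_n`, an operator on `H_n`. -/
def restrictRange (R : K →L[ℂ] K) (n : ℕ) : rangeClosure R n →L[ℂ] rangeClosure R n :=
  R.restrict (map_mem_rangeClosure R n)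

/-- The isometric part `θ_R` of the polar decomposition `R = θ_R R_1^{1/2}` of an injective
operator `R`: the continuous extension of `R_1^{1/2} x ↦ R x` from the (dense) range of
`R_1^{1/2}`. -/
def polarIsometry (R : K →L[ℂ] K) : K →L[ℂ] K :=
  (R : K →ₗ[ℂ] K).extendOfNorm (CFC.sqrt (gram R 1) : K →L[ℂ] K).toLinearMap

/-- The isometry `θ_{R,n} = θ_{R|H_{n-1}} ⋯ θ_{R|H_1} θ_{R|H_0}`, where `θ_{R|H_j}` is seen as a
partial isometry of the whole space that vanishes on the orthogonal complement of `H_j`. -/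
def thetaIter (R : K →L[ℂ] K) : ℕ → (K →L[ℂ] K)
  | 0 => ContinuousLinearMap.id ℂ K
  | n + 1 => ((rangeClosure R n).subtypeL ∘L polarIsometry (restrictRange R n) ∘L
      (rangeClosure R n).orthogonalProjectionOnto) ∘L thetaIter R n

/-- The subspace `M_E ⊖ E`, as a subspace of `H_1 = E^⊥`. -/
def reducedSubspace (R : K →L[ℂ] K) : Submodule ℂ (rangeClosure R 1) :=
  (cyclicSubspace R ⊓ (kerAdj R)ᗮ).comap (rangeClosure R 1).subtype

/-- The set `F` of all triples `(λ, γ, m)` with `λ ∈ σ(𝕄_R|M_E)`, `γ ∈ σ(𝕄_{R|H_1}|(M_E ⊖ E))`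
and `m ≥ 1` such that `γ(P R_k P) = λ(θ_{R,m}^* R_k θ_{R,m})` for all `k`, where `P` is the
orthogonal projection onto `H_1`. Here `a` and `b` are the operators `θ_{R,m}^* R_k θ_{R,m}` and
`P R_k P`, restricted to `M_E` and `M_E ⊖ E`. -/
def tripleSet (R : K →L[ℂ] K) :
    Set (restrictedSpectrum (gramAlgebra R) (cyclicSubspace R) ×
      restrictedSpectrum (gramAlgebra (restrictRange R 1)) (reducedSubspace R) × ℕ) :=
  {t | 1 ≤ t.2.2 ∧ ∀ k : ℕ,
    ∃ a : restrictedAlgebra (gramAlgebra R) (cyclicSubspace R),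
    ∃ b : restrictedAlgebra (gramAlgebra (restrictRange R 1)) (reducedSubspace R),
      (∀ x : cyclicSubspace R, (a.1 x : K) =
        ContinuousLinearMap.adjoint (thetaIter R t.2.2)
          (gram R k (thetaIter R t.2.2 (x : K)))) ∧
      (∀ x : reducedSubspace R, ((b.1 x : rangeClosure R 1) : K) =
        (rangeClosure R 1).starProjection
          (gram R k ((rangeClosure R 1).starProjection ((x : rangeClosure R 1) : K)))) ∧
      t.2.1 b = t.1 a}

/-- `J` is a weighted shift, with nonzero weights, with respect to the orthonormal basis `x`. -/
def IsWeightedShift (x : HilbertBasis ℕ ℂ K) (J : K →L[ℂ] K) : Prop :=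
  ∃ w : ℕ → ℂ, (∀ k, w k ≠ 0) ∧ ∀ k, J (x k) = w k • x (k + 1)

end Operators

end HalfCentered

end

/-!
Write `M` for `M_E`, `T_k` for `T^{*k} T^k`, `P_j` for the projection onto `H_j`, and `θ_j` for
`θ_{T,j}`. A repeated use of the polar decomposition shows that `θ_j` is the isometric factor of
`T^j`, so that `θ_j M` is the closure of `T^j M`, and that `θ_j^* T_k θ_j` belongs to the von
Neumann algebra of `T` (`exists_isPolarPair_thetaIter`, `IsPolarPair.conj_gram_mem`).

*Characters.* Let `X : M → M ⊖ E` intertwine `θ_j^* T_k θ_j` with `P T_k P` for all `k`. The two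
restricted algebras act on the operators `M → M ⊖ E` by right and left multiplication, and together
they generate a commutative Banach algebra. If `X ≠ 0`, a character of this algebra that vanishes
on the annihilator of `X` gives a triple `(λ, γ, j)` in `F`. If there is only one such triple, then
`b - γ(b)` and `a - λ(a)` are quasinilpotent modulo the annihilator of `X`; as powers of normal
operators cannot decay so fast, `b X = γ(b) X` and `X a = λ(a) X` for self-adjoint `a`, `b`
(`exists_character_pair`, `comp_eq_smul_of_unique_pair`).

*The subspace `M ⊖ E`.* Let `W : M ⊖ E → H_j` intertwine the compressions of the `T_k`. If `F` has
no triple ending in `j`, then `W^* θ_j` vanishes on `M`, so the range of `W` is orthogonal to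
`θ_j M`, which forces it into `H_{j+1}`, and one can go on with `j + 1`. Starting from the inclusion
of `M ⊖ E` one reaches `j = n`; there one passes to `W' = (1 - θ_n P_M θ_n^*) W` and continues
beyond `n`. In the end `W'` has range orthogonal to all `T^j M` with `j ≥ 1`, hence `W' = 0` by
density, and `M ⊖ E ⊆ θ_n M` (`exists_theta_eq`). Therefore `X = W^* θ_n` maps `M` onto `M ⊖ E`,
and the uniqueness of the triple makes all `P T_k P` scalar on `M ⊖ E`. Since `E` is
one-dimensional and cyclic for the commuting operators `T_k` on `M`, this gives
`dim (M ⊖ E) ≤ 1` (`exists_eq_smul_of_scalar`), with equality because the character `γ` exists.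

*The basis.* Now `M` has an orthonormal basis `g`, `h` of joint eigenvectors of the `T_k`, and
`T^n g` is a nonzero multiple of the unit vector `f` of `M ⊖ E`. The vectors
`g, T g, …, T^{n-1} g, h, T h, T² h, …` are orthogonal and span a dense subspace; normalized, they
form the basis. Only the vector at place `n - 1` is not mapped to a multiple of the next one: it is
mapped to a multiple of `f`, a combination of `g = x_0` and `h = x_n`
(`exists_weightedShift_of_orbits`).
-/

namespace HalfCentered

/-! ### Characters of commutative Banach algebras and quasinilpotent elements -/

section AbstractCharacters

variable {C : Type*} [NormedCommRing C] [NormedAlgebra ℂ C]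
  {F : Type*} [NormedAddCommGroup F] [NormedSpace ℂ F]

/-- The kernel of a linear map `ev` on a commutative algebra, as an ideal; that it is one is the
assumption `hev`. -/
def kerIdeal (ev : C →L[ℂ] F) (hev : ∀ c d : C, ev c = 0 → ev (d * c) = 0) : Ideal C where
  carrier := {c | ev c = 0}
  add_mem' := by
    intro a b ha hb
    simp only [Set.mem_ofPred_eq] at *
    rw [map_add, ha, hb, add_zero]
  zero_mem' := map_zero ev
  smul_mem' := fun d c hc => hev c d hc

theorem isClosed_kerIdeal (ev : C →L[ℂ] F) (hev : ∀ c d : C, ev c = 0 → ev (d * c) = 0) :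
    IsClosed (kerIdeal ev hev : Set C) :=
  isClosed_singleton.preimage ev.continuous

theorem nontrivial_quotient_kerIdeal (ev : C →L[ℂ] F)
    (hev : ∀ c d : C, ev c = 0 → ev (d * c) = 0) (h1 : ev 1 ≠ 0) :
    Nontrivial (C ⧸ kerIdeal ev hev) := by
  refine Ideal.Quotient.nontrivial_iff.mpr fun h => h1 ?_
  exact (Ideal.eq_top_iff_one _).mp h

/-- A character of the quotient by a closed ideal, pulled back to the algebra. -/
theorem exists_character_of_quotient (I : Ideal C) [IsClosed (I : Set C)]
    (φ : WeakDual.characterSpace ℂ (C ⧸ I)) :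
    ∃ χ : WeakDual.characterSpace ℂ C, ∀ c, χ c = φ (Ideal.Quotient.mk I c) := by
  have hcont : Continuous fun c : C => φ (Ideal.Quotient.mk I c) :=
    (map_continuous φ).comp continuous_quot_mk
  let ψ : C →L[ℂ] ℂ :=
    { toFun := fun c => φ (Ideal.Quotient.mk I c)
      map_add' := fun a b => by simp
      map_smul' := fun z a => by
        have : Ideal.Quotient.mk I (z • a) = z • Ideal.Quotient.mk I a := rfl
        rw [this, map_smul]; rfl
      cont := hcont }
  refine ⟨⟨StrongDual.toWeakDual ψ, ?_⟩, fun c => rfl⟩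
  rw [WeakDual.CharacterSpace.eq_set_map_one_map_mul]
  refine ⟨?_, fun a b => ?_⟩
  · change φ (Ideal.Quotient.mk I 1) = 1
    rw [map_one, map_one]
  · change φ (Ideal.Quotient.mk I (a * b)) = φ (Ideal.Quotient.mk I a) * φ (Ideal.Quotient.mk I b)
    rw [map_mul, map_mul]

/-- The map induced by `ev` on the quotient by its kernel has at most the norm of `ev`. -/
theorem norm_le_norm_quotient (ev : C →L[ℂ] F)
    (hev : ∀ c d : C, ev c = 0 → ev (d * c) = 0) (c : C) :
    ‖ev c‖ ≤ ‖ev‖ * ‖Ideal.Quotient.mk (kerIdeal ev hev) c‖ := by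
  refine le_of_forall_pos_lt_add fun ε hε => ?_
  obtain ⟨d, hd, hdn⟩ := Ideal.Quotient.norm_mk_lt (Ideal.Quotient.mk (kerIdeal ev hev) c)
    (show 0 < ε / (‖ev‖ + 1) by positivity)
  have h : ev c = ev d := by
    have : c - d ∈ kerIdeal ev hev := Ideal.Quotient.eq.mp hd.symm
    have h' : ev (c - d) = 0 := this
    rwa [map_sub, sub_eq_zero] at h'
  rw [h]
  calc ‖ev d‖ ≤ ‖ev‖ * ‖d‖ := ev.le_opNorm d
    _ ≤ ‖ev‖ * (‖Ideal.Quotient.mk (kerIdeal ev hev) c‖ + ε / (‖ev‖ + 1)) := by gcongr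
    _ < _ := by
      rw [mul_add]
      gcongr
      rw [mul_div_assoc', div_lt_iff₀ (by positivity)]
      nlinarith [norm_nonneg ev]

variable [CompleteSpace C]

/-- A linear map whose kernel is a proper ideal has this ideal in the kernel of some character, by
the existence of characters of the quotient. -/
theorem exists_character_vanishing (ev : C →L[ℂ] F)
    (hev : ∀ c d : C, ev c = 0 → ev (d * c) = 0) (h1 : ev 1 ≠ 0) :
    ∃ χ : WeakDual.characterSpace ℂ C, ∀ c, ev c = 0 → χ c = 0 := by
  have := isClosed_kerIdeal ev hev
  have := nontrivial_quotient_kerIdeal ev hev h1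
  obtain ⟨φ⟩ : Nonempty (WeakDual.characterSpace ℂ (C ⧸ kerIdeal ev hev)) := inferInstance
  obtain ⟨χ, hχ⟩ := exists_character_of_quotient _ φ
  refine ⟨χ, fun c hc => ?_⟩
  rw [hχ, Ideal.Quotient.eq_zero_iff_mem.mpr hc, map_zero]

/-- If all the characters that vanish on the kernel of `ev` take the same value `μ` at `c`, then
`c - μ` is quasinilpotent modulo this kernel, so that `ev ((c - μ) ^ n)` decays faster than any
geometric sequence. -/
theorem exists_norm_pow_le (ev : C →L[ℂ] F)
    (hev : ∀ c d : C, ev c = 0 → ev (d * c) = 0) (c : C) (μ : ℂ)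
    (hμ : ∀ χ : WeakDual.characterSpace ℂ C, (∀ d, ev d = 0 → χ d = 0) → χ c = μ)
    {r : ℝ} (hr : 0 < r) :
    ∃ N : ℕ, ∀ n ≥ N, ‖ev ((c - algebraMap ℂ C μ) ^ n)‖ ≤ ‖ev‖ * r ^ n := by
  have := isClosed_kerIdeal ev hev
  set I := kerIdeal ev hev with hI
  set q : C ⧸ I := Ideal.Quotient.mk I (c - algebraMap ℂ C μ) with hq
  have hspec : spectrum ℂ q ⊆ {0} := by
    intro z hz
    obtain ⟨φ, hφ⟩ := WeakDual.CharacterSpace.mem_spectrum_iff_exists.mp hz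
    obtain ⟨χ, hχ⟩ := exists_character_of_quotient I φ
    have h := hμ χ fun d hd => by
      rw [hχ, Ideal.Quotient.eq_zero_iff_mem.mpr hd, map_zero]
    rw [Set.mem_singleton_iff, ← hφ, hq, ← hχ, map_sub, h, AlgHomClass.commutes]
    simp
  have hrad : spectralRadius ℂ q = 0 := by
    rw [spectralRadius]
    refine le_antisymm (iSup₂_le fun z hz => ?_) bot_le
    rw [Set.mem_singleton_iff.mp (hspec hz)]
    simp
  have ht := spectrum.pow_nnnorm_pow_one_div_tendsto_nhds_spectralRadius q
  rw [hrad] at ht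
  have hev' := ht.eventually (gt_mem_nhds (show (0 : ENNReal) < ENNReal.ofReal r by simpa using hr))
  obtain ⟨N, hN⟩ := Filter.eventually_atTop.mp hev'
  refine ⟨max N 1, fun n hn => ?_⟩
  have hn0 : n ≠ 0 := by have := le_of_max_le_right hn; omega
  have h1 := hN n (le_of_max_le_left hn)
  have h2 : (‖q ^ n‖₊ : ENNReal) ≤ ENNReal.ofReal r ^ n := by
    have h3 := pow_le_pow_left' h1.le n
    rwa [← ENNReal.rpow_natCast, ← ENNReal.rpow_mul, one_div,
      inv_mul_cancel₀ (by exact_mod_cast hn0), ENNReal.rpow_one] at h3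
  have h4 : ‖q ^ n‖ ≤ r ^ n := by
    rw [← ENNReal.ofReal_pow hr.le, ← enorm_eq_nnnorm, ← ofReal_norm,
      ENNReal.ofReal_le_ofReal_iff (by positivity)] at h2
    exact h2
  calc _ ≤ ‖ev‖ * ‖Ideal.Quotient.mk I ((c - algebraMap ℂ C μ) ^ n)‖ :=
        norm_le_norm_quotient ev hev _
    _ ≤ _ := by
        rw [map_pow]
        gcongr

end AbstractCharacters

section Normal

variable {E : Type*} [NormedAddCommGroup E] [InnerProductSpace ℂ E] [CompleteSpace E]

theorem norm_apply_sq_le_of_isStarNormal (N : E →L[ℂ] E) (hN : IsStarNormal N) (y : E) :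
    ‖N y‖ ^ 2 ≤ ‖N (N y)‖ * ‖y‖ := by
  have h1 : ‖ContinuousLinearMap.adjoint N (N y)‖ = ‖N (N y)‖ :=
    ((ContinuousLinearMap.isStarNormal_iff_norm_eq_adjoint).mp hN (N y)).symm
  rw [← h1, ContinuousLinearMap.apply_norm_sq_eq_inner_adjoint_left]
  refine (Complex.re_le_norm _).trans ?_
  exact norm_inner_le_norm _ _

/-- The powers of a normal operator grow at least geometrically along every orbit. -/
theorem norm_pow_ge_of_isStarNormal (N : E →L[ℂ] E) (hN : IsStarNormal N) {y : E} {r : ℝ}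
    (hr : 0 ≤ r) (hy : r * ‖y‖ ≤ ‖N y‖) (n : ℕ) : r ^ n * ‖y‖ ≤ ‖(N ^ n) y‖ := by
  have key : ∀ k : ℕ, r * ‖(N ^ k) y‖ ≤ ‖(N ^ (k + 1)) y‖ := by
    intro k
    induction k with
    | zero => simpa using hy
    | succ k ih =>
      have h := norm_apply_sq_le_of_isStarNormal N hN ((N ^ k) y)
      have e1 : N ((N ^ k) y) = (N ^ (k + 1)) y := by rw [pow_succ']; rfl
      have e2 : N ((N ^ (k + 1)) y) = (N ^ (k + 2)) y := by rw [pow_succ' N (k + 1)]; rfl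
      rw [e1, e2] at h
      change _ ≤ ‖(N ^ (k + 2)) y‖
      rcases (norm_nonneg ((N ^ (k + 1)) y)).eq_or_lt with h0 | h0
      · rw [← h0, mul_zero]; exact norm_nonneg _
      · refine le_of_mul_le_mul_right ?_ h0
        nlinarith [norm_nonneg ((N ^ (k + 2)) y)]
  induction n with
  | zero => simp
  | succ n ih =>
    calc r ^ (n + 1) * ‖y‖ = r * (r ^ n * ‖y‖) := by ring
      _ ≤ r * ‖(N ^ n) y‖ := by gcongr
      _ ≤ _ := key n

/-- A normal operator that is quasinilpotent along the orbit of `y` kills `y`. -/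
theorem eq_zero_of_norm_pow_le (N : E →L[ℂ] E) (hN : IsStarNormal N) (y : E)
    (h : ∀ r : ℝ, 0 < r → ∃ (K : ℝ) (M : ℕ), ∀ n ≥ M, ‖(N ^ n) y‖ ≤ K * r ^ n) : N y = 0 := by
  by_contra hne
  have hy : y ≠ 0 := by rintro rfl; simp at hne
  have hy' : 0 < ‖y‖ := norm_pos_iff.mpr hy
  obtain ⟨s, hs0, hsy⟩ : ∃ s : ℝ, 0 < s ∧ s * ‖y‖ ≤ ‖N y‖ :=
    ⟨‖N y‖ / ‖y‖, div_pos (norm_pos_iff.mpr hne) hy', by rw [div_mul_cancel₀ _ hy'.ne']⟩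
  obtain ⟨K, M, hM⟩ := h (s / 2) (by positivity)
  have hbound : ∀ n ≥ M, (2 : ℝ) ^ n ≤ K / ‖y‖ := by
    intro n hn
    have h1 := norm_pow_ge_of_isStarNormal N hN hs0.le hsy n
    have h2 := h1.trans (hM n hn)
    rw [le_div_iff₀ hy']
    rw [div_pow, mul_div_assoc', le_div_iff₀ (by positivity)] at h2
    have h3 : 0 < s ^ n := by positivity
    nlinarith
  obtain ⟨n, hn⟩ := pow_unbounded_of_one_lt (K / ‖y‖) (one_lt_two)
  have h1 := hbound (max n M) (le_max_right _ _)
  have h2 : (2 : ℝ) ^ n ≤ 2 ^ (max n M) := pow_le_pow_right₀ one_le_two (le_max_left _ _)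
  linarith

end Normal

/-! ### Characters attached to an intertwining operator -/

section JointCharacters

/-- The pull-back of a character under a continuous unital homomorphism. -/
theorem exists_character_comp {A C : Type*} [NormedRing A] [NormedAlgebra ℂ A] [NormedRing C]
    [NormedAlgebra ℂ C] (χ : WeakDual.characterSpace ℂ C) (ρ : A →L[ℂ] C) (h1 : ρ 1 = 1)
    (hmul : ∀ a b, ρ (a * b) = ρ a * ρ b) :
    ∃ ψ : WeakDual.characterSpace ℂ A, ∀ a, ψ a = χ (ρ a) := by
  let χ' : C →L[ℂ] ℂ := WeakDual.CharacterSpace.toCLM χ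
  refine ⟨⟨StrongDual.toWeakDual (χ'.comp ρ), ?_⟩, fun a => rfl⟩
  rw [WeakDual.CharacterSpace.eq_set_map_one_map_mul]
  refine ⟨?_, fun a b => ?_⟩
  · change χ (ρ 1) = 1
    rw [h1, map_one]
  · change χ (ρ (a * b)) = χ (ρ a) * χ (ρ b)
    rw [hmul, map_mul]

/-- Pairwise commuting elements of a normed algebra lie in a closed commutative subalgebra: their
double commutant. -/
theorem exists_closed_commutative_subalgebra {Y : Type*} [NormedRing Y] [NormedAlgebra ℂ Y]
    (S : Set Y) (hS : ∀ c ∈ S, ∀ c' ∈ S, c * c' = c' * c) :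
    ∃ C : Subalgebra ℂ Y, IsClosed (C : Set Y) ∧
      (∀ c ∈ C, ∀ c' ∈ C, c * c' = c' * c) ∧ S ⊆ C := by
  refine ⟨Subalgebra.centralizer ℂ (Subalgebra.centralizer ℂ S : Set Y), ?_, ?_, ?_⟩
  · rw [Subalgebra.coe_centralizer]
    exact Set.isClosed_centralizer _
  · intro c hc c' hc'
    refine (Subalgebra.mem_centralizer_iff ℂ).mp hc' c ?_
    refine (Subalgebra.mem_centralizer_iff ℂ).mpr fun s hs => ?_
    refine (Subalgebra.mem_centralizer_iff ℂ).mp hc s ?_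
    exact (Subalgebra.mem_centralizer_iff ℂ).mpr fun s' hs' => hS s' hs' s hs
  · intro s hs
    exact (Subalgebra.mem_centralizer_iff ℂ).mpr fun g hg =>
      ((Subalgebra.mem_centralizer_iff ℂ).mp hg s hs).symm

/-- Let two algebras `A` and `B` map into a Banach algebra `Y` with commuting images, and let `ev`
be a linear map on `Y` whose kernel is a left ideal. The characters of the closed commutative
algebra generated by the images that vanish on the kernel of `ev` give pairs of characters of `A`
and `B` that agree along elements with the same value under `ev`; if there is only one such pair,
then the elements of `A` and `B` are, modulo the kernel, quasinilpotent up to scalars. -/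
theorem exists_character_pair {A B Y F : Type*} [NormedRing A] [NormedAlgebra ℂ A]
    [NormedRing B] [NormedAlgebra ℂ B] [NormedRing Y] [NormedAlgebra ℂ Y] [CompleteSpace Y]
    [NormedAddCommGroup F] [NormedSpace ℂ F] (ρA : A →L[ℂ] Y) (ρB : B →L[ℂ] Y)
    (hA1 : ρA 1 = 1) (hB1 : ρB 1 = 1) (hAmul : ∀ a a', ρA (a * a') = ρA a * ρA a')
    (hBmul : ∀ b b', ρB (b * b') = ρB b * ρB b') (hAA : ∀ a a', ρA a * ρA a' = ρA a' * ρA a)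
    (hBB : ∀ b b', ρB b * ρB b' = ρB b' * ρB b) (hAB : ∀ a b, ρA a * ρB b = ρB b * ρA a)
    (ev : Y →L[ℂ] F) (hev : ∀ c d : Y, ev c = 0 → ev (d * c) = 0) (h1 : ev 1 ≠ 0) :
    (∃ (lam : WeakDual.characterSpace ℂ A) (gam : WeakDual.characterSpace ℂ B),
      ∀ a b, ev (ρA a) = ev (ρB b) → gam b = lam a) ∧
    ∀ (lam : WeakDual.characterSpace ℂ A) (gam : WeakDual.characterSpace ℂ B),
      (∀ (lam' : WeakDual.characterSpace ℂ A) (gam' : WeakDual.characterSpace ℂ B),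
        (∀ a b, ev (ρA a) = ev (ρB b) → gam' b = lam' a) → lam' = lam ∧ gam' = gam) →
      (∀ (b : B) (r : ℝ), 0 < r → ∃ (K : ℝ) (N : ℕ), ∀ n ≥ N,
        ‖ev ((ρB b - algebraMap ℂ Y (gam b)) ^ n)‖ ≤ K * r ^ n) ∧
      (∀ (a : A) (r : ℝ), 0 < r → ∃ (K : ℝ) (N : ℕ), ∀ n ≥ N,
        ‖ev ((ρA a - algebraMap ℂ Y (lam a)) ^ n)‖ ≤ K * r ^ n) := by
  obtain ⟨C, hclosed, hcomm, hC⟩ := exists_closed_commutative_subalgebra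
    (Set.range ρA ∪ Set.range ρB) (by
      rintro c (⟨a, rfl⟩ | ⟨b, rfl⟩) c' (⟨a', rfl⟩ | ⟨b', rfl⟩)
      exacts [hAA a a', hAB a b', (hAB a' b).symm, hBB b b'])
  let _ : NormedCommRing C :=
    { (inferInstance : NormedRing C) with
      mul_comm := fun c c' => Subtype.ext (hcomm c c.2 c' c'.2) }
  have : CompleteSpace C := hclosed.completeSpace_coe
  let evC : C →L[ℂ] F := ev.comp C.toSubmodule.subtypeL
  have hevC : ∀ c d : C, evC c = 0 → evC (d * c) = 0 := fun c d hc => hev c.1 d.1 hc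
  have h1C : evC 1 ≠ 0 := h1
  let σA : A →L[ℂ] C := ρA.codRestrict C.toSubmodule (fun a => hC (Or.inl ⟨a, rfl⟩))
  let σB : B →L[ℂ] C := ρB.codRestrict C.toSubmodule (fun b => hC (Or.inr ⟨b, rfl⟩))
  have hpair : ∀ χ : WeakDual.characterSpace ℂ C, (∀ c, evC c = 0 → χ c = 0) →
      ∃ (lam : WeakDual.characterSpace ℂ A) (gam : WeakDual.characterSpace ℂ B),
        (∀ a b, ev (ρA a) = ev (ρB b) → gam b = lam a) ∧ (∀ a, lam a = χ (σA a)) ∧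
        ∀ b, gam b = χ (σB b) := by
    intro χ hχ
    obtain ⟨lam, hlam⟩ := exists_character_comp χ σA (Subtype.ext hA1)
      (fun a a' => Subtype.ext (hAmul a a'))
    obtain ⟨gam, hgam⟩ := exists_character_comp χ σB (Subtype.ext hB1)
      (fun a a' => Subtype.ext (hBmul a a'))
    refine ⟨lam, gam, fun a b hab => ?_, hlam, hgam⟩
    have h : χ (σB b - σA a) = 0 := by
      refine hχ _ ?_
      change ev (ρB b - ρA a) = 0
      rw [map_sub, hab, sub_self]
    rw [hlam, hgam]
    rwa [map_sub, sub_eq_zero] at h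
  refine ⟨?_, fun lam gam huniq => ⟨fun b r hr => ?_, fun a r hr => ?_⟩⟩
  · obtain ⟨χ, hχ⟩ := exists_character_vanishing evC hevC h1C
    obtain ⟨lam, gam, h, -⟩ := hpair χ hχ
    exact ⟨lam, gam, h⟩
  · obtain ⟨N, hN⟩ := exists_norm_pow_le evC hevC (σB b) (gam b) (fun χ hχ => by
      obtain ⟨lam', gam', h, -, hg⟩ := hpair χ hχ
      rw [← hg, (huniq _ _ h).2]) hr
    exact ⟨‖evC‖, N, hN⟩
  · obtain ⟨N, hN⟩ := exists_norm_pow_le evC hevC (σA a) (lam a) (fun χ hχ => by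
      obtain ⟨lam', gam', h, hl, -⟩ := hpair χ hχ
      rw [← hl, (huniq _ _ h).1]) hr
    exact ⟨‖evC‖, N, hN⟩

variable {M V : Type*} [NormedAddCommGroup M] [NormedSpace ℂ M]
  [NormedAddCommGroup V] [NormedSpace ℂ V]

/-- A pair of characters of `𝒜` and `ℬ` that agrees along every pair of operators intertwined
by `X`. -/
def IsIntertwinedPair (𝒜 : Subalgebra ℂ (M →L[ℂ] M)) (ℬ : Subalgebra ℂ (V →L[ℂ] V))
    (X : M →L[ℂ] V) (lam : WeakDual.characterSpace ℂ 𝒜) (gam : WeakDual.characterSpace ℂ ℬ) :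
    Prop :=
  ∀ (a : 𝒜) (b : ℬ), X ∘L a.1 = b.1 ∘L X → gam b = lam a

/-- A nonzero operator `X` between spaces that carry commutative operator algebras has an
intertwined pair of characters; if this pair is unique, then `b - γ(b)` and `a - λ(a)` act
quasinilpotently on `X`, by multiplication from the left and from the right. -/
theorem exists_isIntertwinedPair [CompleteSpace V] (𝒜 : Subalgebra ℂ (M →L[ℂ] M))
    (ℬ : Subalgebra ℂ (V →L[ℂ] V)) (h𝒜 : ∀ a ∈ 𝒜, ∀ a' ∈ 𝒜, a * a' = a' * a)
    (hℬ : ∀ b ∈ ℬ, ∀ b' ∈ ℬ, b * b' = b' * b) (X : M →L[ℂ] V) (hX : X ≠ 0) :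
    (∃ lam gam, IsIntertwinedPair 𝒜 ℬ X lam gam) ∧
    ∀ lam gam, (∀ lam' gam', IsIntertwinedPair 𝒜 ℬ X lam' gam' → lam' = lam ∧ gam' = gam) →
      (∀ (b : ℬ) (r : ℝ), 0 < r → ∃ (K : ℝ) (N : ℕ), ∀ n ≥ N,
        ‖((b.1 - gam b • (1 : V →L[ℂ] V)) ^ n) ∘L X‖ ≤ K * r ^ n) ∧
      (∀ (a : 𝒜) (r : ℝ), 0 < r → ∃ (K : ℝ) (N : ℕ), ∀ n ≥ N,
        ‖X ∘L ((a.1 - lam a • (1 : M →L[ℂ] M)) ^ n)‖ ≤ K * r ^ n) := by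
  let lft : (V →L[ℂ] V) →L[ℂ] ((M →L[ℂ] V) →L[ℂ] (M →L[ℂ] V)) :=
    ContinuousLinearMap.compL ℂ M V V
  let rgt : (M →L[ℂ] M) →L[ℂ] ((M →L[ℂ] V) →L[ℂ] (M →L[ℂ] V)) :=
    (ContinuousLinearMap.compL ℂ M M V).flip
  have hr_mul : ∀ a a', rgt (a * a') = rgt a' * rgt a := fun a a' => rfl
  have hl_mul : ∀ b b', lft (b * b') = lft b * lft b' := fun b b' => rfl
  let ρA : 𝒜 →L[ℂ] ((M →L[ℂ] V) →L[ℂ] (M →L[ℂ] V)) := rgt.comp 𝒜.toSubmodule.subtypeL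
  let ρB : ℬ →L[ℂ] ((M →L[ℂ] V) →L[ℂ] (M →L[ℂ] V)) := lft.comp ℬ.toSubmodule.subtypeL
  let ev : ((M →L[ℂ] V) →L[ℂ] (M →L[ℂ] V)) →L[ℂ] (M →L[ℂ] V) :=
    ContinuousLinearMap.apply ℂ (M →L[ℂ] V) X
  have hAmul : ∀ a a' : 𝒜, ρA (a * a') = ρA a * ρA a' := fun a a' => by
    change rgt (a.1 * a'.1) = rgt a.1 * rgt a'.1
    rw [h𝒜 a a.2 a' a'.2, hr_mul]
  have hBmul : ∀ b b' : ℬ, ρB (b * b') = ρB b * ρB b' := fun b b' => hl_mul b.1 b'.1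
  have hAA : ∀ a a' : 𝒜, ρA a * ρA a' = ρA a' * ρA a := fun a a' => by
    rw [← hAmul, ← hAmul]
    exact congrArg ρA (Subtype.ext (h𝒜 a a.2 a' a'.2))
  have hBB : ∀ b b' : ℬ, ρB b * ρB b' = ρB b' * ρB b := fun b b' => by
    rw [← hBmul, ← hBmul]
    exact congrArg ρB (Subtype.ext (hℬ b b.2 b' b'.2))
  have hev : ∀ c d : (M →L[ℂ] V) →L[ℂ] (M →L[ℂ] V), ev c = 0 → ev (d * c) = 0 := fun c d hc => by
    change d (c X) = 0
    change c X = 0 at hc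
    rw [hc, map_zero]
  obtain ⟨h1, h2⟩ := exists_character_pair (A := 𝒜) (B := ℬ)
    (Y := (M →L[ℂ] V) →L[ℂ] (M →L[ℂ] V)) (F := M →L[ℂ] V) ρA ρB rfl rfl hAmul hBmul hAA hBB
    (fun a b => rfl) ev hev hX
  refine ⟨h1, fun lam gam huniq => ?_⟩
  obtain ⟨h3, h4⟩ := h2 lam gam huniq
  refine ⟨fun b r hr => ?_, fun a r hr => ?_⟩
  · obtain ⟨K, N, hN⟩ := h3 b r hr
    refine ⟨K, N, fun n hn => ?_⟩
    have e : ∀ n : ℕ, ((lft b.1 - algebraMap ℂ _ (gam b)) ^ n) X =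
        ((b.1 - gam b • (1 : V →L[ℂ] V)) ^ n) ∘L X := by
      intro n
      induction n with
      | zero => rfl
      | succ n ih =>
        rw [pow_succ', pow_succ']
        change (lft b.1 - algebraMap ℂ _ (gam b)) (((lft b.1 - algebraMap ℂ _ (gam b)) ^ n) X) = _
        rw [ih]
        rfl
    rw [← e]
    exact hN n hn
  · obtain ⟨K, N, hN⟩ := h4 a r hr
    refine ⟨K, N, fun n hn => ?_⟩
    have e : ∀ n : ℕ, ((rgt a.1 - algebraMap ℂ _ (lam a)) ^ n) X =
        X ∘L ((a.1 - lam a • (1 : M →L[ℂ] M)) ^ n) := by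
      intro n
      induction n with
      | zero => rfl
      | succ n ih =>
        rw [pow_succ', pow_succ]
        change (rgt a.1 - algebraMap ℂ _ (lam a)) (((rgt a.1 - algebraMap ℂ _ (lam a)) ^ n) X) = _
        rw [ih]
        ext x
        change X (((a.1 - lam a • (1 : M →L[ℂ] M)) ^ n) (a.1 x)) -
          lam a • X (((a.1 - lam a • (1 : M →L[ℂ] M)) ^ n) x) =
          X (((a.1 - lam a • (1 : M →L[ℂ] M)) ^ n) (a.1 x - lam a • x))
        rw [map_sub, map_smul, map_sub, map_smul]
    rw [← e]
    exact hN n hn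

end JointCharacters

section UniquePair

variable {M V : Type*} [NormedAddCommGroup M] [InnerProductSpace ℂ M] [CompleteSpace M]
  [NormedAddCommGroup V] [InnerProductSpace ℂ V] [CompleteSpace V]

/-- If the intertwined pair of characters is unique, then all normal operators of the two algebras
act on `X` as scalars. -/
theorem comp_eq_smul_of_unique_pair (𝒜 : Subalgebra ℂ (M →L[ℂ] M))
    (ℬ : Subalgebra ℂ (V →L[ℂ] V)) (h𝒜 : ∀ a ∈ 𝒜, ∀ a' ∈ 𝒜, a * a' = a' * a)
    (hℬ : ∀ b ∈ ℬ, ∀ b' ∈ ℬ, b * b' = b' * b) (X : M →L[ℂ] V) (hX : X ≠ 0)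
    (lam : WeakDual.characterSpace ℂ 𝒜) (gam : WeakDual.characterSpace ℂ ℬ)
    (huniq : ∀ lam' gam', IsIntertwinedPair 𝒜 ℬ X lam' gam' → lam' = lam ∧ gam' = gam) :
    (∀ b : ℬ, IsSelfAdjoint b.1 → b.1 ∘L X = gam b • X) ∧
    (∀ a : 𝒜, IsSelfAdjoint a.1 → X ∘L a.1 = lam a • X) := by
  obtain ⟨h1, h2⟩ := (exists_isIntertwinedPair 𝒜 ℬ h𝒜 hℬ X hX).2 lam gam huniq
  constructor
  · intro b hb
    set N : V →L[ℂ] V := b.1 - gam b • 1 with hN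
    have hnorm : IsStarNormal N := by
      rw [isStarNormal_iff, hN, star_sub, star_smul, star_one, hb.star_eq]
      exact ((Commute.refl _).sub_left ((Commute.one_left _).smul_left _)).sub_right
        ((Commute.one_right _).smul_right _)
    ext x
    have h := eq_zero_of_norm_pow_le N hnorm (X x) fun r hr => by
      obtain ⟨K, N', hK⟩ := h1 b r hr
      refine ⟨K * ‖x‖, N', fun n hn => ?_⟩
      calc ‖(N ^ n) (X x)‖ ≤ ‖(N ^ n) ∘L X‖ * ‖x‖ := ((N ^ n) ∘L X).le_opNorm x
        _ ≤ (K * r ^ n) * ‖x‖ := by gcongr; exact hK n hn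
        _ = _ := by ring
    simpa [hN, sub_eq_zero] using h
  · intro a ha
    set N : M →L[ℂ] M := a.1 - lam a • 1 with hN
    have hstar : IsStarNormal N := by
      rw [isStarNormal_iff, hN, star_sub, star_smul, star_one, ha.star_eq]
      exact ((Commute.refl _).sub_left ((Commute.one_left _).smul_left _)).sub_right
        ((Commute.one_right _).smul_right _)
    have hnorm : IsStarNormal (star N) := hstar.star
    have h : ∀ y, star N (ContinuousLinearMap.adjoint X y) = 0 := fun y =>
      eq_zero_of_norm_pow_le (star N) hnorm _ fun r hr => by
        obtain ⟨K, N', hK⟩ := h2 a r hr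
        refine ⟨K * ‖y‖, N', fun n hn => ?_⟩
        have e : ((star N) ^ n) ∘L (ContinuousLinearMap.adjoint X) =
            ContinuousLinearMap.adjoint (X ∘L N ^ n) := by
          rw [ContinuousLinearMap.adjoint_comp, ← star_pow]
          rfl
        calc ‖((star N) ^ n) (ContinuousLinearMap.adjoint X y)‖
            ≤ ‖((star N) ^ n) ∘L (ContinuousLinearMap.adjoint X)‖ * ‖y‖ :=
              (((star N) ^ n) ∘L (ContinuousLinearMap.adjoint X)).le_opNorm y
          _ = ‖X ∘L N ^ n‖ * ‖y‖ := by rw [e, LinearIsometryEquiv.norm_map]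
          _ ≤ (K * r ^ n) * ‖y‖ := by gcongr; exact hK n hn
          _ = _ := by ring
    have h0 : X ∘L N = 0 := by
      have : ContinuousLinearMap.adjoint (X ∘L N) = 0 := by
        rw [ContinuousLinearMap.adjoint_comp]
        ext y
        exact h y
      exact ContinuousLinearMap.adjoint.injective (this.trans (map_zero _).symm)
    rw [hN] at h0
    ext x
    have := congrArg (fun f => f x) h0
    simpa [sub_eq_zero] using this

/-- If `X a = c X`, then the adjoint of `X` takes its values in an eigenspace of `a`. -/
theorem apply_eq_conj_smul_of_comp_eq_smul {L : Type*} [NormedAddCommGroup L]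
    [InnerProductSpace ℂ L] (X : M →L[ℂ] L) (a : M →L[ℂ] M)
    (ha : IsSelfAdjoint a) {c : ℂ} (hc : X ∘L a = c • X) {g : M} {y : L}
    (h : ∀ u, ⟪X u, y⟫_ℂ = ⟪u, g⟫_ℂ) : a g = (starRingEnd ℂ) c • g := by
  refine ext_inner_left ℂ fun v => ?_
  have h1 : X (a v) = c • X v := congrArg (fun f => f v) hc
  have h2 : ⟪a v, g⟫_ℂ = ⟪v, a g⟫_ℂ := ha.isSymmetric v g
  rw [← h2, ← h, h1, inner_smul_left, h, inner_smul_right]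

end UniquePair

/-! ### Polar decompositions of the powers -/

section GramAlgebra

variable {K : Type*} [NormedAddCommGroup K] [InnerProductSpace ℂ K] [CompleteSpace K]

theorem inner_gram_left (R : K →L[ℂ] K) (k : ℕ) (x y : K) :
    ⟪gram R k x, y⟫_ℂ = ⟪(R ^ k) x, (R ^ k) y⟫_ℂ :=
  ContinuousLinearMap.adjoint_inner_left (R ^ k) y ((R ^ k) x)

theorem inner_gram_right (R : K →L[ℂ] K) (k : ℕ) (x y : K) :
    ⟪x, gram R k y⟫_ℂ = ⟪(R ^ k) x, (R ^ k) y⟫_ℂ :=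
  ContinuousLinearMap.adjoint_inner_right (R ^ k) x ((R ^ k) y)

theorem inner_apply_eq_of_isSelfAdjoint {S : K →L[ℂ] K} (hS : IsSelfAdjoint S) (x y : K) :
    ⟪S x, y⟫_ℂ = ⟪x, S y⟫_ℂ := hS.isSymmetric x y

theorem gram_eq_star_mul (R : K →L[ℂ] K) (k : ℕ) : gram R k = star (R ^ k) * R ^ k := rfl

theorem isSelfAdjoint_gram (R : K →L[ℂ] K) (k : ℕ) : IsSelfAdjoint (gram R k) :=
  IsSelfAdjoint.star_mul_self (R ^ k)

theorem inner_pow_pow_of_le (R : K →L[ℂ] K) {i j : ℕ} (h : j ≤ i) (x y : K) :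
    ⟪(R ^ i) x, (R ^ j) y⟫_ℂ = ⟪(R ^ (i - j)) x, gram R j y⟫_ℂ := by
  rw [inner_gram_right, ← mul_apply_eq_comp, ← pow_add, Nat.add_sub_cancel' h]

theorem mem_gramAlgebra_of_commute {R a : K →L[ℂ] K}
    (h : ∀ c : K →L[ℂ] K, (∀ k, Commute c (gram R k)) → Commute c a) : a ∈ gramAlgebra R := by
  change a ∈ StarSubalgebra.centralizer ℂ
    (StarSubalgebra.centralizer ℂ (Set.range (gram R)) : Set (K →L[ℂ] K))
  rw [StarSubalgebra.mem_centralizer_iff]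
  intro g hg
  have hg' := (StarSubalgebra.mem_centralizer_iff ℂ).mp hg
  constructor
  · refine h g fun k => ?_
    exact (hg' _ ⟨k, rfl⟩).1.symm
  · refine h (star g) fun k => ?_
    have h1 : gram R k * g = g * gram R k := (hg' _ ⟨k, rfl⟩).1
    have h2 := congrArg star h1
    rw [star_mul, star_mul, (isSelfAdjoint_gram R k).star_eq] at h2
    exact h2

theorem commute_of_mem_gramAlgebra {R a c : K →L[ℂ] K} (ha : a ∈ gramAlgebra R)
    (hc : ∀ k, Commute c (gram R k)) : Commute c a := by
  have ha' := (StarSubalgebra.mem_centralizer_iff ℂ).mp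
    (show a ∈ StarSubalgebra.centralizer ℂ
      (StarSubalgebra.centralizer ℂ (Set.range (gram R)) : Set (K →L[ℂ] K)) from ha)
  refine (ha' c ?_).1
  change c ∈ StarSubalgebra.centralizer ℂ (Set.range (gram R))
  rw [StarSubalgebra.mem_centralizer_iff]
  rintro _ ⟨k, rfl⟩
  rw [(isSelfAdjoint_gram R k).star_eq]
  exact ⟨(hc k).symm, (hc k).symm⟩

theorem gram_mem_gramAlgebra (R : K →L[ℂ] K) (k : ℕ) : gram R k ∈ gramAlgebra R :=
  mem_gramAlgebra_of_commute fun _ hc => hc k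

theorem commute_of_mem_gramAlgebra_of_mem {R a b : K →L[ℂ] K} (hR : IsHalfCentered R)
    (ha : a ∈ gramAlgebra R) (hb : b ∈ gramAlgebra R) : Commute a b :=
  commute_of_mem_gramAlgebra hb fun k =>
    (commute_of_mem_gramAlgebra ha fun j => hR k j).symm

theorem gram_mul_conj (R : K →L[ℂ] K) (k m : ℕ) :
    star (R ^ m) * gram R k * R ^ m = gram R (k + m) := by
  rw [gram_eq_star_mul, gram_eq_star_mul, pow_add, star_mul]
  simp only [mul_assoc]

/-- An injective self-adjoint operator maps a closed reducing subspace onto a dense subset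
of it. -/
theorem mem_closure_image_of_reducing {S : K →L[ℂ] K} (hS : IsSelfAdjoint S)
    (hinj : Function.Injective S) (V : Submodule ℂ K) [CompleteSpace V]
    (hV : ∀ x ∈ V, S x ∈ V) : V ≤ (V.map S.toLinearMap).topologicalClosure := by
  intro x hx
  rw [← Submodule.orthogonal_orthogonal_eq_closure]
  intro y hy
  set p := V.starProjection y with hp
  have hpV : p ∈ V := V.starProjection_apply_mem y
  have h2 : ∀ v ∈ V, ⟪v, y⟫_ℂ = ⟪v, p⟫_ℂ := by
    intro v hv
    have := V.starProjection_inner_eq_zero y v hv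
    rw [← inner_conj_symm v y, ← inner_conj_symm v p]
    rw [inner_sub_left, sub_eq_zero] at this
    rw [this]
  have h3 : S p = 0 := by
    have h4 : ⟪S (S p), y⟫_ℂ = 0 :=
      hy _ ⟨S p, hV _ hpV, rfl⟩
    rw [h2 _ (hV _ (hV _ hpV)), inner_apply_eq_of_isSelfAdjoint hS, inner_self_eq_zero] at h4
    exact h4
  have h5 : p = 0 := hinj (h3.trans (map_zero S).symm)
  rw [← inner_conj_symm, h2 x hx, h5, inner_zero_right, map_zero]

theorem denseRange_of_isSelfAdjoint {S : K →L[ℂ] K} (hS : IsSelfAdjoint S)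
    (hinj : Function.Injective S) : DenseRange S := by
  intro x
  have : CompleteSpace (⊤ : Submodule ℂ K) := isClosed_univ.completeSpace_coe
  have h := mem_closure_image_of_reducing hS hinj ⊤ (fun _ _ => trivial) (show x ∈ ⊤ from trivial)
  rw [Submodule.map_top] at h
  exact h

end GramAlgebra

section Polar

variable {K : Type*} [NormedAddCommGroup K] [InnerProductSpace ℂ K] [CompleteSpace K]

theorem gram_one_nonneg (R : K →L[ℂ] K) : 0 ≤ gram R 1 := star_mul_self_nonneg (R ^ 1)

theorem isSelfAdjoint_sqrt_gram (R : K →L[ℂ] K) : IsSelfAdjoint (CFC.sqrt (gram R 1)) :=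
  (CFC.sqrt_nonneg _).isSelfAdjoint

theorem norm_sqrt_gram_apply (R : K →L[ℂ] K) (x : K) :
    ‖CFC.sqrt (gram R 1) x‖ = ‖R x‖ := by
  have h : CFC.sqrt (gram R 1) * CFC.sqrt (gram R 1) = gram R 1 :=
    CFC.sqrt_mul_sqrt_self _ (gram_one_nonneg R)
  have h1 : ⟪CFC.sqrt (gram R 1) x, CFC.sqrt (gram R 1) x⟫_ℂ = ⟪R x, R x⟫_ℂ := by
    have e : ⟪gram R 1 x, x⟫_ℂ = ⟪R x, R x⟫_ℂ := by rw [inner_gram_left, pow_one]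
    rw [← e, inner_apply_eq_of_isSelfAdjoint (isSelfAdjoint_sqrt_gram R), ← mul_apply_eq_comp, h,
      inner_apply_eq_of_isSelfAdjoint (isSelfAdjoint_gram R 1)]
  rw [inner_self_eq_norm_sq_to_K, inner_self_eq_norm_sq_to_K] at h1
  exact (sq_eq_sq₀ (norm_nonneg _) (norm_nonneg _)).mp (by exact_mod_cast h1)

theorem sqrt_gram_injective {R : K →L[ℂ] K} (hR : Function.Injective R) :
    Function.Injective (CFC.sqrt (gram R 1) : K →L[ℂ] K) := by
  rw [injective_iff_map_eq_zero]
  intro x hx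
  have := norm_sqrt_gram_apply R x
  rw [hx, norm_zero] at this
  exact hR ((norm_eq_zero.mp this.symm).trans (map_zero R).symm)

theorem polarIsometry_sqrt_gram {R : K →L[ℂ] K} (hR : Function.Injective R) (x : K) :
    polarIsometry R (CFC.sqrt (gram R 1) x) = R x :=
  LinearMap.extendOfNorm_eq (f := (R : K →ₗ[ℂ] K))
    (e := (CFC.sqrt (gram R 1) : K →L[ℂ] K).toLinearMap)
    (denseRange_of_isSelfAdjoint (isSelfAdjoint_sqrt_gram R) (sqrt_gram_injective hR))
    ⟨1, fun y => by
      rw [one_mul]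
      exact (norm_sqrt_gram_apply R y).ge⟩ x

theorem norm_polarIsometry_apply {R : K →L[ℂ] K} (hR : Function.Injective R) (x : K) :
    ‖polarIsometry R x‖ = ‖x‖ := by
  have hd := denseRange_of_isSelfAdjoint (isSelfAdjoint_sqrt_gram R) (sqrt_gram_injective hR)
  refine hd.induction_on (p := fun x => ‖polarIsometry R x‖ = ‖x‖) x ?_ fun y => ?_
  · exact isClosed_eq (by fun_prop) (by fun_prop)
  · rw [polarIsometry_sqrt_gram hR, norm_sqrt_gram_apply]

theorem polarIsometry_mem {R : K →L[ℂ] K} (hR : Function.Injective R) (x : K) :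
    polarIsometry R x ∈ closure (Set.range R) := by
  have hd := denseRange_of_isSelfAdjoint (isSelfAdjoint_sqrt_gram R) (sqrt_gram_injective hR)
  refine hd.induction_on (p := fun x => polarIsometry R x ∈ closure (Set.range R)) x ?_
    fun y => ?_
  · exact isClosed_closure.preimage (polarIsometry R).continuous
  · rw [polarIsometry_sqrt_gram hR]
    exact subset_closure ⟨y, rfl⟩

end Polar

section RangeClosure

variable {K : Type*} [NormedAddCommGroup K] [InnerProductSpace ℂ K]

theorem pow_injective {R : K →L[ℂ] K} (hR : Function.Injective R) (m : ℕ) :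
    Function.Injective (R ^ m : K →L[ℂ] K) := by
  induction m with
  | zero => exact Function.injective_id
  | succ m ih =>
    rw [pow_succ]
    exact ih.comp hR

theorem rangeClosure_succ_le (R : K →L[ℂ] K) (m : ℕ) :
    rangeClosure R (m + 1) ≤ rangeClosure R m := by
  refine Submodule.topologicalClosure_mono ?_
  rintro _ ⟨x, rfl⟩
  exact ⟨R x, by rw [pow_succ]; rfl⟩

theorem rangeClosure_le_of_le (R : K →L[ℂ] K) {i j : ℕ} (h : i ≤ j) :
    rangeClosure R j ≤ rangeClosure R i := by
  induction j, h using Nat.le_induction with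
  | base => exact le_rfl
  | succ j _ ih => exact (rangeClosure_succ_le R j).trans ih

theorem apply_mem_rangeClosure_succ (R : K →L[ℂ] K) (m : ℕ) {x : K}
    (hx : x ∈ rangeClosure R m) : R x ∈ rangeClosure R (m + 1) := by
  refine map_mem_closure R.continuous hx ?_
  rintro _ ⟨y, rfl⟩
  exact ⟨y, by rw [pow_succ']; rfl⟩

end RangeClosure

section Theta

variable {K : Type*} [NormedAddCommGroup K] [InnerProductSpace ℂ K] [CompleteSpace K]

/-- `R ^ m = θ S` is a polar decomposition of `R ^ m`: the operator `θ` is an isometry into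
`H_m` (hence onto `H_m`, which is the closure of the range of `θ S`), and `S` is a
self-adjoint operator in the von Neumann algebra of `R`. The positivity of `S` is not recorded. -/
structure IsPolarPair (R : K →L[ℂ] K) (m : ℕ) (θ S : K →L[ℂ] K) : Prop where
  star_mul_self : star θ * θ = 1
  mem_rangeClosure : ∀ x, θ x ∈ rangeClosure R m
  isSelfAdjoint : IsSelfAdjoint S
  mem_gramAlgebra : S ∈ gramAlgebra R
  pow_eq : R ^ m = θ * S

namespace IsPolarPair

variable {R θ S : K →L[ℂ] K} {m : ℕ}

theorem star_apply_apply (h : IsPolarPair R m θ S) (x : K) : star θ (θ x) = x :=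
  congrArg (fun f => f x) h.star_mul_self

theorem injective (h : IsPolarPair R m θ S) (hR : Function.Injective R) :
    Function.Injective S := by
  intro x y hxy
  refine pow_injective hR m ?_
  rw [h.pow_eq]
  exact congrArg θ hxy

theorem apply_star_apply (h : IsPolarPair R m θ S) {y : K} (hy : y ∈ rangeClosure R m) :
    θ (star θ y) = y := by
  have hc : IsClosed {y | θ (star θ y) = y} := isClosed_eq (by fun_prop) (by fun_prop)
  refine hc.closure_subset_iff.mpr ?_ hy
  rintro _ ⟨x, rfl⟩
  change θ (star θ ((R ^ m) x)) = (R ^ m) x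
  rw [h.pow_eq]
  exact congrArg θ (h.star_apply_apply (S x))

theorem mul_star_self (h : IsPolarPair R m θ S) :
    θ * star θ = (rangeClosure R m).starProjection := by
  ext y
  refine ((rangeClosure R m).eq_starProjection_of_mem_of_inner_eq_zero
    (h.mem_rangeClosure _) fun w hw => ?_).symm
  change ⟪y - θ (star θ y), w⟫_ℂ = 0
  rw [inner_sub_left, ← h.apply_star_apply hw, sub_eq_zero]
  have e : ⟪θ (star θ y), θ (star θ w)⟫_ℂ = ⟪star θ y, star θ (θ (star θ w))⟫_ℂ :=
    (ContinuousLinearMap.adjoint_inner_right _ _ _).symm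
  rw [e, h.star_apply_apply]
  exact (ContinuousLinearMap.adjoint_inner_left _ _ _).symm

/-- The operators `θ^* R_k θ` belong to the von Neumann algebra of `R`, since
`S (θ^* R_k θ) S = R_{k+m}` and `S` is injective with dense range. -/
theorem conj_gram_mem (h : IsPolarPair R m θ S) (hR : Function.Injective R) (k : ℕ) :
    star θ * gram R k * θ ∈ gramAlgebra R := by
  refine mem_gramAlgebra_of_commute fun c hc => ?_
  set D := star θ * gram R k * θ with hD
  have h1 : S * D * S = gram R (k + m) := by
    rw [← gram_mul_conj, h.pow_eq, star_mul, h.isSelfAdjoint.star_eq, hD]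
    simp only [mul_assoc]
  have hcS : c * S = S * c := commute_of_mem_gramAlgebra h.mem_gramAlgebra hc
  have h2 : S * (c * D) * S = S * (D * c) * S := by
    calc S * (c * D) * S = (S * c) * D * S := by simp only [mul_assoc]
      _ = c * (S * D * S) := by rw [← hcS]; simp only [mul_assoc]
      _ = (S * D * S) * c := by rw [h1]; exact hc _
      _ = S * D * (S * c) := by simp only [mul_assoc]
      _ = _ := by rw [← hcS]; simp only [mul_assoc]
  have hd := denseRange_of_isSelfAdjoint h.isSelfAdjoint (h.injective hR)
  have h3 : (⇑(c * D)) = ⇑(D * c) := by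
    refine hd.equalizer (c * D).continuous (D * c).continuous ?_
    funext x
    exact h.injective hR (congrArg (fun f => f x) h2)
  exact DFunLike.coe_injective h3

end IsPolarPair

theorem restrictRange_apply (R : K →L[ℂ] K) (m : ℕ) (x : rangeClosure R m) :
    ((restrictRange R m x : rangeClosure R m) : K) = R x := rfl

theorem restrictRange_pow_apply (R : K →L[ℂ] K) (m k : ℕ) (x : rangeClosure R m) :
    (((restrictRange R m) ^ k) x : K) = (R ^ k) x := by
  induction k with
  | zero => rfl
  | succ k ih =>
    rw [pow_succ', pow_succ', mul_apply_eq_comp, mul_apply_eq_comp,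
      restrictRange_apply, ih]

theorem restrictRange_injective {R : K →L[ℂ] K} (hR : Function.Injective R) (m : ℕ) :
    Function.Injective (restrictRange R m) := fun _ _ hxy =>
  Subtype.ext (hR (congrArg Subtype.val hxy))

theorem coe_gram_restrictRange_apply (R : K →L[ℂ] K) (m k : ℕ) (x : rangeClosure R m) :
    ((gram (restrictRange R m) k x : rangeClosure R m) : K) =
      (rangeClosure R m).starProjection (gram R k x) := by
  refine ((rangeClosure R m).eq_starProjection_of_mem_of_inner_eq_zero
    (Subtype.coe_prop _) fun w hw => ?_).symm
  rw [inner_sub_left, inner_gram_left, sub_eq_zero]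
  have := inner_gram_left (restrictRange R m) k x ⟨w, hw⟩
  rw [Submodule.coe_inner, Submodule.coe_inner, restrictRange_pow_apply,
    restrictRange_pow_apply] at this
  exact this.symm

end Theta

section ThetaIter

variable {K : Type*} [NormedAddCommGroup K] [InnerProductSpace ℂ K] [CompleteSpace K]

/-- Conjugation by a unitary carries the square root of an operator to an operator that commutes
with everything that commutes with the conjugated operator. -/
theorem commute_conj_sqrt {L : Type*} [NormedAddCommGroup L] [InnerProductSpace ℂ L]
    [CompleteSpace L] (W : K →L[ℂ] L) (hW : ContinuousLinearMap.adjoint W ∘L W = 1)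
    (hW' : W ∘L ContinuousLinearMap.adjoint W = 1) (G : L →L[ℂ] L) (c : K →L[ℂ] K)
    (hc : Commute c (ContinuousLinearMap.adjoint W ∘L G ∘L W)) :
    Commute c (ContinuousLinearMap.adjoint W ∘L CFC.sqrt G ∘L W) := by
  set W' := ContinuousLinearMap.adjoint W with hWdef
  have e1 : ∀ x, W' (W x) = x := fun x => congrArg (fun f => f x) hW
  have e2 : ∀ x, W (W' x) = x := fun x => congrArg (fun f => f x) hW'
  set d : L →L[ℂ] L := W ∘L c ∘L W' with hd
  have h1 : Commute d G := by
    ext y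
    change W (c (W' (G y))) = G (W (c (W' y)))
    have h := congrArg (fun f => W (f (W' y))) hc.eq
    change W (c (W' (G (W (W' y))))) = W (W' (G (W (c (W' y))))) at h
    rwa [e2, e2] at h
  have h2 : Commute d (CFC.sqrt G) := (h1.symm.cfcₙ_nnreal NNReal.sqrt).symm
  ext x
  have h := congrArg (fun f => W' (f (W x))) h2.eq
  change W' (W (c (W' (CFC.sqrt G (W x))))) = W' (CFC.sqrt G (W (c (W' (W x))))) at h
  rw [e1, e1] at h
  exact h

/-- From `R ^ m = θ S` to `R ^ (m + 1)`: if `R|H_m = U |R|H_m|`, then `R ^ (m + 1) = (U θ) (θ^*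
|R|H_m| θ S)`, where the last factor is self-adjoint because `θ^* |R|H_m| θ`, the square root of
`θ^* R_1 θ`, lies in the commutative von Neumann algebra of `R`. -/
theorem IsPolarPair.step {R θ S : K →L[ℂ] K} {m : ℕ} (hR : Function.Injective R)
    (hhalf : IsHalfCentered R) (h : IsPolarPair R m θ S) :
    ∃ S', IsPolarPair R (m + 1) (((rangeClosure R m).subtypeL ∘L
      polarIsometry (restrictRange R m) ∘L
        (rangeClosure R m).orthogonalProjectionOnto) ∘L θ) S' := by
  set Hm := rangeClosure R m with hHm
  set Q := restrictRange R m with hQ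
  have hQinj : Function.Injective Q := restrictRange_injective hR m
  set U := polarIsometry Q with hU
  -- `W` is `θ`, seen as a unitary operator onto `H_m`.
  set W : K →L[ℂ] Hm := Hm.orthogonalProjectionOnto ∘L θ with hWdef
  have hWcoe : ∀ x, (W x : K) = θ x := fun x =>
    Hm.starProjection_eq_self_iff.mpr (h.mem_rangeClosure x)
  have hWadj : ∀ y : Hm, ContinuousLinearMap.adjoint W y = star θ (y : K) := by
    intro y
    rw [hWdef, ContinuousLinearMap.adjoint_comp, Submodule.adjoint_orthogonalProjectionOnto]
    rfl
  have hWW : ContinuousLinearMap.adjoint W ∘L W = 1 := by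
    ext x
    change ContinuousLinearMap.adjoint W (W x) = x
    rw [hWadj, hWcoe, h.star_apply_apply]
  have hWW' : W ∘L ContinuousLinearMap.adjoint W = 1 := by
    ext y
    change (W (ContinuousLinearMap.adjoint W y) : K) = y
    rw [hWcoe, hWadj, h.apply_star_apply y.2]
  set B := ContinuousLinearMap.adjoint W ∘L CFC.sqrt (gram Q 1) ∘L W with hB
  have hD : ContinuousLinearMap.adjoint W ∘L gram Q 1 ∘L W = star θ * gram R 1 * θ := by
    ext x
    change ContinuousLinearMap.adjoint W (gram Q 1 (W x)) = star θ (gram R 1 (θ x))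
    rw [hWadj, coe_gram_restrictRange_apply, hWcoe, ← h.mul_star_self]
    exact h.star_apply_apply _
  have hBmem : B ∈ gramAlgebra R := by
    refine mem_gramAlgebra_of_commute fun c hc => ?_
    refine commute_conj_sqrt W hWW hWW' (gram Q 1) c ?_
    rw [hD]
    exact commute_of_mem_gramAlgebra (h.conj_gram_mem hR 1) hc
  have hBsa : IsSelfAdjoint B := (isSelfAdjoint_sqrt_gram Q).adjoint_conj W
  have hnorm : ∀ x, ‖((Hm.subtypeL ∘L U ∘L Hm.orthogonalProjectionOnto) ∘L θ) x‖ = ‖x‖ := by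
    intro x
    change ‖(U (W x) : Hm)‖ = ‖x‖
    rw [norm_polarIsometry_apply hQinj]
    change ‖(W x : K)‖ = ‖x‖
    rw [hWcoe]
    exact (ContinuousLinearMap.norm_map_iff_adjoint_comp_self θ).mpr h.star_mul_self x
  refine ⟨B * S, ?_, ?_, ?_, ?_, ?_⟩
  · exact (ContinuousLinearMap.norm_map_iff_adjoint_comp_self _).mp hnorm
  · intro x
    change ((U (W x) : Hm) : K) ∈ rangeClosure R (m + 1)
    have hcl : IsClosed {y : Hm | (y : K) ∈ rangeClosure R (m + 1)} :=
      (Submodule.isClosed_topologicalClosure _).preimage continuous_subtype_val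
    refine hcl.closure_subset_iff.mpr ?_ (polarIsometry_mem hQinj (W x))
    rintro _ ⟨y, rfl⟩
    exact apply_mem_rangeClosure_succ R m y.2
  · exact (hBsa.commute_iff h.isSelfAdjoint).mp
      (commute_of_mem_gramAlgebra_of_mem hhalf hBmem h.mem_gramAlgebra)
  · exact mul_mem hBmem h.mem_gramAlgebra
  · ext x
    have e1 : W (B (S x)) = CFC.sqrt (gram Q 1) (W (S x)) :=
      congrArg (fun f => f (CFC.sqrt (gram Q 1) (W (S x)))) hWW'
    change (R ^ (m + 1)) x = ((U (W (B (S x))) : Hm) : K)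
    rw [e1, hU, polarIsometry_sqrt_gram hQinj, restrictRange_apply, hWcoe, pow_succ', h.pow_eq]
    rfl

/-- The isometries `θ_{R,m}` are the isometric factors of the powers `R ^ m`. -/
theorem exists_isPolarPair_thetaIter {R : K →L[ℂ] K} (hR : Function.Injective R)
    (hhalf : IsHalfCentered R) (m : ℕ) : ∃ S, IsPolarPair R m (thetaIter R m) S := by
  induction m with
  | zero =>
    refine ⟨1, ?_, ?_, ?_, ?_, ?_⟩
    · change star (1 : K →L[ℂ] K) * 1 = 1
      rw [star_one, one_mul]
    · intro x
      exact Submodule.le_topologicalClosure _ ⟨x, rfl⟩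
    · exact IsSelfAdjoint.one _
    · exact one_mem _
    · rfl
  | succ m ih =>
    obtain ⟨S, hS⟩ := ih
    exact hS.step hR hhalf

end ThetaIter

/-! ### The subspace `M_E` and intertwiners -/

section RestrictedAlgebra

variable {K : Type*} [NormedAddCommGroup K] [InnerProductSpace ℂ K] [CompleteSpace K]

/-- The restriction of an element of `𝒜` to an invariant subspace, as an element of `𝒜|V`. -/
def restrictOp (𝒜 : VonNeumannAlgebra K) (V : Submodule ℂ K) (a : K →L[ℂ] K) (ha : a ∈ 𝒜)
    (hV : ∀ x ∈ V, a x ∈ V) : restrictedAlgebra 𝒜 V :=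
  ⟨a.restrict hV, a, ha, fun _ => rfl⟩

theorem isSelfAdjoint_restrictOp (𝒜 : VonNeumannAlgebra K) (V : Submodule ℂ K) [CompleteSpace V]
    (a : K →L[ℂ] K) (ha : a ∈ 𝒜) (hV : ∀ x ∈ V, a x ∈ V) (hsa : IsSelfAdjoint a) :
    IsSelfAdjoint (restrictOp 𝒜 V a ha hV).1 := by
  rw [ContinuousLinearMap.isSelfAdjoint_iff_isSymmetric]
  intro x y
  exact inner_apply_eq_of_isSelfAdjoint hsa (x : K) y

theorem restrictedAlgebra_mul_comm {R : K →L[ℂ] K} (hR : IsHalfCentered R) (V : Submodule ℂ K) :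
    ∀ a ∈ restrictedAlgebra (gramAlgebra R) V, ∀ a' ∈ restrictedAlgebra (gramAlgebra R) V,
      a * a' = a' * a := by
  rintro a ⟨c, hc, hac⟩ a' ⟨c', hc', hac'⟩
  ext x
  change ((a (a' x) : V) : K) = a' (a x)
  rw [hac, hac', hac', hac]
  exact congrArg (fun f => f (x : K)) (commute_of_mem_gramAlgebra_of_mem hR hc hc').eq

/-- A closed subspace that is invariant under all the `R_k` is invariant under the von Neumann
algebra they generate. -/
theorem apply_mem_of_mem_gramAlgebra {R : K →L[ℂ] K} (V : Submodule ℂ K) [CompleteSpace V]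
    (hV : ∀ k : ℕ, ∀ x ∈ V, gram R k x ∈ V) {a : K →L[ℂ] K} (ha : a ∈ gramAlgebra R) :
    ∀ x ∈ V, a x ∈ V := by
  have hP : ∀ k, Commute V.starProjection (gram R k) := by
    intro k
    have h1 : V.starProjection * gram R k * V.starProjection = gram R k * V.starProjection := by
      ext x
      exact V.starProjection_eq_self_iff.mpr (hV k _ (V.starProjection_apply_mem x))
    have h2 := congrArg star h1
    simp only [star_mul, (isSelfAdjoint_gram R k).star_eq,
      (isSelfAdjoint_starProjection V).star_eq] at h2
    rw [mul_assoc] at h1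
    exact h2.symm.trans h1
  have h := commute_of_mem_gramAlgebra ha hP
  intro x hx
  rw [← V.starProjection_eq_self_iff, ← mul_apply_eq_comp, h.eq, mul_apply_eq_comp,
    V.starProjection_eq_self_iff.mpr hx]

end RestrictedAlgebra

section CyclicSubspace

-- The instances on the subspace `M_E ⊖ E` of the subspace `H_1` need a deeper search.
set_option maxSynthPendingDepth 5

variable {K : Type*} [NormedAddCommGroup K] [InnerProductSpace ℂ K] [CompleteSpace K]

theorem isClosed_cyclicSubspace (R : K →L[ℂ] K) : IsClosed (cyclicSubspace R : Set K) := by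
  rw [cyclicSubspace, Submodule.coe_sInf]
  exact isClosed_biInter fun V hV => hV.1

instance (R : K →L[ℂ] K) : CompleteSpace (cyclicSubspace R) :=
  (isClosed_cyclicSubspace R).completeSpace_coe

theorem kerAdj_le_cyclicSubspace (R : K →L[ℂ] K) : kerAdj R ≤ cyclicSubspace R :=
  le_sInf fun _ hV => hV.2.1

theorem gram_apply_mem_cyclicSubspace (R : K →L[ℂ] K) (k : ℕ) :
    ∀ x ∈ cyclicSubspace R, gram R k x ∈ cyclicSubspace R := by
  intro x hx
  rw [cyclicSubspace, Submodule.mem_sInf] at hx ⊢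
  exact fun V hV => hV.2.2 k x (hx V hV)

theorem cyclicSubspace_le {R : K →L[ℂ] K} {V : Submodule ℂ K} (hV : IsClosed (V : Set K))
    (hE : kerAdj R ≤ V) (hk : ∀ k : ℕ, ∀ x ∈ V, gram R k x ∈ V) : cyclicSubspace R ≤ V :=
  sInf_le ⟨hV, hE, hk⟩

theorem apply_mem_cyclicSubspace {R a : K →L[ℂ] K} (ha : a ∈ gramAlgebra R) :
    ∀ x ∈ cyclicSubspace R, a x ∈ cyclicSubspace R :=
  apply_mem_of_mem_gramAlgebra _ (gram_apply_mem_cyclicSubspace R) ha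

/-- The subspace `E` is cyclic for the operators `R_k` on `M_E`, so a joint eigenvector cannot be
orthogonal to it. -/
theorem eq_zero_of_joint_eigenvector {R : K →L[ℂ] K} {f : K} (hf : f ∈ cyclicSubspace R)
    (hE : ∀ e ∈ kerAdj R, ⟪f, e⟫_ℂ = 0) (c : ℕ → ℂ) (hc : ∀ k, gram R k f = c k • f) :
    f = 0 := by
  have h : cyclicSubspace R ≤ (ℂ ∙ f)ᗮ := by
    refine cyclicSubspace_le (Submodule.isClosed_orthogonal _) ?_ ?_
    · intro e he
      exact Submodule.mem_orthogonal_singleton_iff_inner_right.mpr (hE e he)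
    · intro k x hx
      rw [Submodule.mem_orthogonal_singleton_iff_inner_right] at hx ⊢
      rw [← inner_apply_eq_of_isSelfAdjoint (isSelfAdjoint_gram R k), hc, inner_smul_left, hx,
        mul_zero]
  exact inner_self_eq_zero.mp (Submodule.mem_orthogonal_singleton_iff_inner_right.mp (h hf))

theorem rangeClosure_one_eq (R : K →L[ℂ] K) : rangeClosure R 1 = (kerAdj R)ᗮ := by
  rw [rangeClosure, ← Submodule.orthogonal_orthogonal_eq_closure, pow_one]
  exact congrArg _ (ContinuousLinearMap.orthogonal_range R)

theorem mem_rangeClosure_one_iff (R : K →L[ℂ] K) (x : K) :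
    x ∈ rangeClosure R 1 ↔ ∀ e ∈ kerAdj R, ⟪e, x⟫_ℂ = 0 := by
  rw [rangeClosure_one_eq]
  exact Submodule.mem_orthogonal _ _

theorem mem_kerAdj_iff (R : K →L[ℂ] K) (x : K) :
    x ∈ kerAdj R ↔ ∀ y, ⟪x, R y⟫_ℂ = 0 := by
  constructor
  · intro h y
    rw [← ContinuousLinearMap.adjoint_inner_left, show ContinuousLinearMap.adjoint R x = 0 from h,
      inner_zero_left]
  · intro h
    change ContinuousLinearMap.adjoint R x = 0
    rw [← inner_self_eq_zero (𝕜 := ℂ), ContinuousLinearMap.adjoint_inner_left]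
    exact h _

theorem mem_reducedSubspace_iff (R : K →L[ℂ] K) (x : rangeClosure R 1) :
    x ∈ reducedSubspace R ↔ (x : K) ∈ cyclicSubspace R := by
  have h : (x : K) ∈ (kerAdj R)ᗮ := by
    rw [← rangeClosure_one_eq]
    exact x.2
  exact ⟨fun hx => hx.1, fun hx => ⟨hx, h⟩⟩

instance (R : K →L[ℂ] K) : CompleteSpace (reducedSubspace R) := by
  refine IsClosed.completeSpace_coe (s := (reducedSubspace R : Set (rangeClosure R 1)))
    (hs := ?_)
  have : (reducedSubspace R : Set (rangeClosure R 1)) =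
      Subtype.val ⁻¹' (cyclicSubspace R : Set K) := by
    ext x
    exact mem_reducedSubspace_iff R x
  rw [this]
  exact (isClosed_cyclicSubspace R).preimage continuous_subtype_val

theorem sub_starProjection_mem_kerAdj (R : K →L[ℂ] K) (x : K) :
    x - (rangeClosure R 1).starProjection x ∈ kerAdj R := by
  have h2 := (rangeClosure R 1).sub_starProjection_mem_orthogonal x
  have h3 : (rangeClosure R 1)ᗮ = kerAdj R := by
    rw [rangeClosure, Submodule.orthogonal_closure, pow_one]
    exact ContinuousLinearMap.orthogonal_range R
  rwa [h3] at h2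

theorem starProjection_apply_mem_cyclicSubspace (R : K →L[ℂ] K) {x : K}
    (hx : x ∈ cyclicSubspace R) :
    (rangeClosure R 1).starProjection x ∈ cyclicSubspace R := by
  have h := sub_mem hx (kerAdj_le_cyclicSubspace R (sub_starProjection_mem_kerAdj R x))
  rwa [sub_sub_cancel] at h

theorem gram_restrictRange_apply_mem_reducedSubspace (R : K →L[ℂ] K) (k : ℕ) :
    ∀ x ∈ reducedSubspace R, gram (restrictRange R 1) k x ∈ reducedSubspace R := by
  intro x hx
  rw [mem_reducedSubspace_iff] at hx ⊢
  rw [coe_gram_restrictRange_apply]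
  exact starProjection_apply_mem_cyclicSubspace R (gram_apply_mem_cyclicSubspace R k _ hx)

/-- The restriction of a half-centered operator to the closure of its range is again
half-centered. -/
theorem isHalfCentered_restrictRange_one {R : K →L[ℂ] K} (hR : Function.Injective R)
    (hhalf : IsHalfCentered R) : IsHalfCentered (restrictRange R 1) := by
  obtain ⟨S, hS⟩ := exists_isPolarPair_thetaIter hR hhalf 1
  set θ := thetaIter R 1
  have key : ∀ j k (x : rangeClosure R 1),
      ((gram (restrictRange R 1) j (gram (restrictRange R 1) k x) : rangeClosure R 1) : K) =
      θ (((star θ * gram R j * θ) * (star θ * gram R k * θ)) (star θ x)) := by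
    intro j k x
    rw [coe_gram_restrictRange_apply, coe_gram_restrictRange_apply, ← hS.mul_star_self]
    conv_lhs => rw [← hS.apply_star_apply x.2]
    rfl
  intro j k
  ext x
  change ((gram (restrictRange R 1) j (gram (restrictRange R 1) k x) : rangeClosure R 1) : K) =
    (gram (restrictRange R 1) k (gram (restrictRange R 1) j x) : rangeClosure R 1)
  rw [key, key, (commute_of_mem_gramAlgebra_of_mem hhalf (hS.conj_gram_mem hR j)
    (hS.conj_gram_mem hR k)).eq]

/-- The operator `P R_k P` on `M_E ⊖ E`. -/
noncomputable def gramReduced (R : K →L[ℂ] K) (k : ℕ) :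
    restrictedAlgebra (gramAlgebra (restrictRange R 1)) (reducedSubspace R) :=
  restrictOp _ _ (gram (restrictRange R 1) k) (gram_mem_gramAlgebra _ k)
    (gram_restrictRange_apply_mem_reducedSubspace R k)

theorem coe_gramReduced_apply (R : K →L[ℂ] K) (k : ℕ) (x : reducedSubspace R) :
    ((((gramReduced R k).1 x : reducedSubspace R) : rangeClosure R 1) : K) =
      (rangeClosure R 1).starProjection (gram R k ((x : rangeClosure R 1) : K)) :=
  coe_gram_restrictRange_apply R 1 k x

theorem isSelfAdjoint_gramReduced (R : K →L[ℂ] K) (k : ℕ) :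
    IsSelfAdjoint (gramReduced R k).1 :=
  isSelfAdjoint_restrictOp _ _ _ _ _ (isSelfAdjoint_gram _ k)

end CyclicSubspace

section Intertwiners

-- The instances on the subspace `M_E ⊖ E` of the subspace `H_1` need a deeper search.
set_option maxSynthPendingDepth 5

variable {K : Type*} [NormedAddCommGroup K] [InnerProductSpace ℂ K] [CompleteSpace K]

/-- An operator `W` from `M_E ⊖ E` to `H_j` that intertwines the compressions of the `R_k` to
`M_E ⊖ E` and to `H_j`. -/
structure IsIntertwiner (R : K →L[ℂ] K) (j : ℕ) (W : reducedSubspace R →L[ℂ] K) : Prop where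
  mem_rangeClosure : ∀ x, W x ∈ rangeClosure R j
  apply_gramReduced : ∀ k x,
    W ((gramReduced R k).1 x) = (rangeClosure R j).starProjection (gram R k (W x))

/-- The operator `W^* θ_j` from `M_E` to `M_E ⊖ E`. -/
noncomputable def crossOp (R : K →L[ℂ] K) (j : ℕ) (W : reducedSubspace R →L[ℂ] K) :
    cyclicSubspace R →L[ℂ] reducedSubspace R :=
  ContinuousLinearMap.adjoint W ∘L thetaIter R j ∘L (cyclicSubspace R).subtypeL

theorem inner_crossOp_left (R : K →L[ℂ] K) (j : ℕ) (W : reducedSubspace R →L[ℂ] K)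
    (x : cyclicSubspace R) (y : reducedSubspace R) :
    ⟪crossOp R j W x, y⟫_ℂ = ⟪thetaIter R j x, W y⟫_ℂ :=
  ContinuousLinearMap.adjoint_inner_left W y (thetaIter R j x)

/-- The operator `θ_{R,m}^* R_k θ_{R,m}` on `M_E`. -/
theorem exists_conjGram {R : K →L[ℂ] K} (hR : Function.Injective R) (hhalf : IsHalfCentered R)
    (m k : ℕ) : ∃ a : restrictedAlgebra (gramAlgebra R) (cyclicSubspace R),
      ∀ x : cyclicSubspace R, (a.1 x : K) =
        ContinuousLinearMap.adjoint (thetaIter R m) (gram R k (thetaIter R m (x : K))) := by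
  obtain ⟨S, hS⟩ := exists_isPolarPair_thetaIter hR hhalf m
  exact ⟨restrictOp _ _ _ (hS.conj_gram_mem hR k)
    (apply_mem_cyclicSubspace (hS.conj_gram_mem hR k)), fun x => rfl⟩

/-- The operator `W^* θ_j` intertwines `θ_j^* R_k θ_j` with `P R_k P`. -/
theorem IsIntertwiner.crossOp_comp {R : K →L[ℂ] K} (hR : Function.Injective R)
    (hhalf : IsHalfCentered R) {j : ℕ} {W : reducedSubspace R →L[ℂ] K}
    (hW : IsIntertwiner R j W) (k : ℕ)
    (a : restrictedAlgebra (gramAlgebra R) (cyclicSubspace R))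
    (ha : ∀ x : cyclicSubspace R, (a.1 x : K) =
        ContinuousLinearMap.adjoint (thetaIter R j) (gram R k (thetaIter R j (x : K)))) :
    crossOp R j W ∘L a.1 = (gramReduced R k).1 ∘L crossOp R j W := by
  obtain ⟨S, hS⟩ := exists_isPolarPair_thetaIter hR hhalf j
  set θ := thetaIter R j
  set Pj := (rangeClosure R j).starProjection with hPj
  have hPsa : ∀ x y, ⟪Pj x, y⟫_ℂ = ⟪x, Pj y⟫_ℂ := fun x y =>
    inner_apply_eq_of_isSelfAdjoint (isSelfAdjoint_starProjection _) x y
  have hP : ∀ x ∈ rangeClosure R j, Pj x = x := fun x hx =>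
    (rangeClosure R j).starProjection_eq_self_iff.mpr hx
  ext1 x
  refine ext_inner_right ℂ fun y => ?_
  change ⟪crossOp R j W (a.1 x), y⟫_ℂ = ⟪(gramReduced R k).1 (crossOp R j W x), y⟫_ℂ
  rw [inner_crossOp_left, ha, inner_apply_eq_of_isSelfAdjoint (isSelfAdjoint_gramReduced R k),
    inner_crossOp_left, hW.apply_gramReduced, ← hPj, ← hPsa, hP _ (hS.mem_rangeClosure _),
    ← inner_apply_eq_of_isSelfAdjoint (isSelfAdjoint_gram R k)]
  have e : θ (ContinuousLinearMap.adjoint θ (gram R k (θ x))) = Pj (gram R k (θ x)) :=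
    congrArg (fun f => f (gram R k (θ x))) hS.mul_star_self
  rw [e, hPsa, hP _ (hW.mem_rangeClosure y)]

/-- An intertwined pair of characters for `W^* θ_m` gives an element of the set `F`. -/
theorem IsIntertwiner.mem_tripleSet {R : K →L[ℂ] K} (hR : Function.Injective R)
    (hhalf : IsHalfCentered R) {m : ℕ} (hm : 1 ≤ m) {W : reducedSubspace R →L[ℂ] K}
    (hW : IsIntertwiner R m W)
    (lam : restrictedSpectrum (gramAlgebra R) (cyclicSubspace R))
    (gam : restrictedSpectrum (gramAlgebra (restrictRange R 1)) (reducedSubspace R))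
    (h : IsIntertwinedPair _ _ (crossOp R m W) lam gam) : (lam, gam, m) ∈ tripleSet R := by
  refine ⟨hm, fun k => ?_⟩
  obtain ⟨a, ha⟩ := exists_conjGram hR hhalf m k
  refine ⟨a, gramReduced R k, ha, fun x => ?_, h a _ (hW.crossOp_comp hR hhalf k a ha)⟩
  rw [coe_gramReduced_apply,
    (rangeClosure R 1).starProjection_eq_self_iff.mpr (x : rangeClosure R 1).2]

theorem IsIntertwiner.crossOp_eq_zero {R : K →L[ℂ] K} (hR : Function.Injective R)
    (hhalf : IsHalfCentered R) {m : ℕ} (hm : 1 ≤ m) {W : reducedSubspace R →L[ℂ] K}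
    (hW : IsIntertwiner R m W) (hF : ∀ t ∈ tripleSet R, t.2.2 ≠ m) : crossOp R m W = 0 := by
  by_contra hne
  obtain ⟨lam, gam, h⟩ := (exists_isIntertwinedPair _ _
    (restrictedAlgebra_mul_comm hhalf (cyclicSubspace R))
    (restrictedAlgebra_mul_comm (isHalfCentered_restrictRange_one hR hhalf) (reducedSubspace R))
    (crossOp R m W) hne).1
  exact hF _ (hW.mem_tripleSet hR hhalf hm lam gam h) rfl

/-- A vector of `H_j` that is orthogonal to `θ_j M_E` belongs to `H_{j+1}`, since `M_E^⊥` is a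
reducing subspace contained in `H_1`. -/
theorem mem_rangeClosure_succ_of_orthogonal {R : K →L[ℂ] K} (hR : Function.Injective R)
    (hhalf : IsHalfCentered R) {j : ℕ} {y : K} (hy : y ∈ rangeClosure R j)
    (hperp : ∀ x ∈ cyclicSubspace R, ⟪thetaIter R j x, y⟫_ℂ = 0) :
    y ∈ rangeClosure R (j + 1) := by
  obtain ⟨S, hS⟩ := exists_isPolarPair_thetaIter hR hhalf j
  set θ := thetaIter R j
  set z := star θ y with hz
  have hzM : z ∈ (cyclicSubspace R)ᗮ := by
    rw [Submodule.mem_orthogonal]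
    intro x hx
    rw [hz]
    exact (ContinuousLinearMap.adjoint_inner_right θ x y).trans (hperp x hx)
  have hinv : ∀ x ∈ (cyclicSubspace R)ᗮ, S x ∈ (cyclicSubspace R)ᗮ := by
    intro x hx
    rw [Submodule.mem_orthogonal] at hx ⊢
    intro u hu
    rw [← inner_apply_eq_of_isSelfAdjoint hS.isSelfAdjoint]
    exact hx _ (apply_mem_cyclicSubspace hS.mem_gramAlgebra u hu)
  have hcl := mem_closure_image_of_reducing hS.isSelfAdjoint (hS.injective hR)
    (cyclicSubspace R)ᗮ hinv hzM
  rw [← hS.apply_star_apply hy, ← hz]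
  have hcl' : IsClosed {x | θ x ∈ rangeClosure R (j + 1)} :=
    (Submodule.isClosed_topologicalClosure _).preimage θ.continuous
  refine hcl'.closure_subset_iff.mpr ?_ hcl
  rintro _ ⟨x, hx, rfl⟩
  change θ (S x) ∈ rangeClosure R (j + 1)
  have e : θ (S x) = (R ^ j) x := by rw [hS.pow_eq]; rfl
  rw [e]
  have hx1 : x ∈ rangeClosure R 1 := by
    rw [mem_rangeClosure_one_iff]
    exact fun u hu => hx u (kerAdj_le_cyclicSubspace R hu)
  refine map_mem_closure (R ^ j).continuous hx1 ?_
  rintro _ ⟨u, rfl⟩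
  exact ⟨u, by rw [pow_add]; rfl⟩

theorem IsIntertwiner.succ {R : K →L[ℂ] K} (hR : Function.Injective R)
    (hhalf : IsHalfCentered R) {j : ℕ} {W : reducedSubspace R →L[ℂ] K}
    (hW : IsIntertwiner R j W) (h0 : ∀ x ∈ cyclicSubspace R, ∀ y,
      ⟪thetaIter R j x, W y⟫_ℂ = 0) : IsIntertwiner R (j + 1) W := by
  have hmem : ∀ y, W y ∈ rangeClosure R (j + 1) := fun y =>
    mem_rangeClosure_succ_of_orthogonal hR hhalf (hW.mem_rangeClosure y) fun x hx => h0 x hx y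
  refine ⟨hmem, fun k x => ?_⟩
  have h1 := hW.apply_gramReduced k x
  have h2 : (rangeClosure R (j + 1)).starProjection (W ((gramReduced R k).1 x)) =
      W ((gramReduced R k).1 x) :=
    (rangeClosure R (j + 1)).starProjection_eq_self_iff.mpr (hmem _)
  rw [← h2, h1, ← mul_apply_eq_comp]
  exact congrArg (fun f => f (gram R k (W x)))
    (Submodule.starProjection_comp_starProjection_of_le (rangeClosure_succ_le R j))

theorem inner_theta_eq_zero_of_crossOp {R : K →L[ℂ] K} {j : ℕ} {W : reducedSubspace R →L[ℂ] K}
    (h : crossOp R j W = 0) : ∀ x ∈ cyclicSubspace R, ∀ y, ⟪thetaIter R j x, W y⟫_ℂ = 0 := by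
  intro x hx y
  have := inner_crossOp_left R j W ⟨x, hx⟩ y
  rw [h] at this
  rw [← this]
  exact inner_zero_left _

end Intertwiners

/-! ### Consequences of `F` being a single triple -/

section Inclusion

-- The instances on the subspace `M_E ⊖ E` of the subspace `H_1` need a deeper search.
set_option maxSynthPendingDepth 5

variable {K : Type*} [NormedAddCommGroup K] [InnerProductSpace ℂ K] [CompleteSpace K]
  {R : K →L[ℂ] K}

/-- The inclusion of `M_E ⊖ E` in the whole space. -/
noncomputable def reducedIncl (R : K →L[ℂ] K) : reducedSubspace R →L[ℂ] K :=
  (rangeClosure R 1).subtypeL ∘L (reducedSubspace R).subtypeL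

theorem reducedIncl_mem_rangeClosure (R : K →L[ℂ] K) (y : reducedSubspace R) :
    reducedIncl R y ∈ rangeClosure R 1 := (y : rangeClosure R 1).2

theorem reducedIncl_mem_cyclicSubspace (R : K →L[ℂ] K) (y : reducedSubspace R) :
    reducedIncl R y ∈ cyclicSubspace R := (mem_reducedSubspace_iff R y).mp y.2

theorem inner_reducedIncl (R : K →L[ℂ] K) (x y : reducedSubspace R) :
    ⟪reducedIncl R x, reducedIncl R y⟫_ℂ = ⟪x, y⟫_ℂ := rfl

theorem exists_reducedIncl_eq {x : K} (hx : x ∈ cyclicSubspace R)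
    (hx1 : x ∈ rangeClosure R 1) : ∃ y : reducedSubspace R, reducedIncl R y = x :=
  ⟨⟨⟨x, hx1⟩, (mem_reducedSubspace_iff R ⟨x, hx1⟩).mpr hx⟩, rfl⟩

theorem isIntertwiner_reducedIncl (R : K →L[ℂ] K) : IsIntertwiner R 1 (reducedIncl R) :=
  ⟨reducedIncl_mem_rangeClosure R, fun k x => coe_gramReduced_apply R k x⟩

/-- If all the triples of `F` have the last entry `n`, then `M_E ⊖ E ⊆ H_j` for `j ≤ n`, and the
inclusion is an intertwiner. -/
theorem isIntertwiner_reducedIncl_of_le (hR : Function.Injective R) (hhalf : IsHalfCentered R)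
    {n : ℕ} (hF : ∀ t ∈ tripleSet R, t.2.2 = n) {j : ℕ} (hj : 1 ≤ j) (hjn : j ≤ n) :
    IsIntertwiner R j (reducedIncl R) := by
  induction j, hj using Nat.le_induction with
  | base => exact isIntertwiner_reducedIncl R
  | succ j hj ih =>
    have hW := ih (by omega)
    exact hW.succ hR hhalf (inner_theta_eq_zero_of_crossOp
      (hW.crossOp_eq_zero hR hhalf hj fun t ht h => by have := hF t ht; omega))

theorem inner_pow_eq_zero_of_theta (hR : Function.Injective R) (hhalf : IsHalfCentered R)
    {j : ℕ} {z : K} (h : ∀ x ∈ cyclicSubspace R, ⟪thetaIter R j x, z⟫_ℂ = 0) :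
    ∀ x ∈ cyclicSubspace R, ⟪(R ^ j) x, z⟫_ℂ = 0 := by
  obtain ⟨S, hS⟩ := exists_isPolarPair_thetaIter hR hhalf j
  intro x hx
  rw [hS.pow_eq]
  exact h _ (apply_mem_cyclicSubspace hS.mem_gramAlgebra x hx)

theorem inner_pow_succ_eq_zero_of_mem_kerAdj {e : K} (he : e ∈ kerAdj R) (j : ℕ) (x : K) :
    ⟪(R ^ (j + 1)) x, e⟫_ℂ = 0 := by
  rw [pow_succ', ← inner_conj_symm, mul_apply_eq_comp, (mem_kerAdj_iff R e).mp he, map_zero]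

/-- If all the triples of `F` have the last entry `n`, then `R^j M_E ⊥ M_E` for `0 < j < n`. -/
theorem inner_pow_apply_eq_zero (hR : Function.Injective R) (hhalf : IsHalfCentered R)
    {n : ℕ} (hF : ∀ t ∈ tripleSet R, t.2.2 = n) {j : ℕ} (hj : 1 ≤ j) (hjn : j < n) {x y : K}
    (hx : x ∈ cyclicSubspace R) (hy : y ∈ cyclicSubspace R) : ⟪(R ^ j) x, y⟫_ℂ = 0 := by
  have hW := isIntertwiner_reducedIncl_of_le hR hhalf hF hj hjn.le
  have h0 := inner_theta_eq_zero_of_crossOp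
      (hW.crossOp_eq_zero hR hhalf hj fun t ht h => by have := hF t ht; omega)
  obtain ⟨v, hv⟩ := exists_reducedIncl_eq (starProjection_apply_mem_cyclicSubspace R hy)
    ((rangeClosure R 1).starProjection_apply_mem y)
  have h1 := inner_pow_eq_zero_of_theta hR hhalf (fun x hx => h0 x hx v) x hx
  obtain ⟨i, rfl⟩ := Nat.exists_eq_succ_of_ne_zero (show j ≠ 0 by omega)
  have h2 := inner_pow_succ_eq_zero_of_mem_kerAdj (sub_starProjection_mem_kerAdj R y) i x
  rw [hv] at h1
  rwa [inner_sub_right, h1, sub_zero] at h2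

end Inclusion

section Compression

-- The instances on the subspace `M_E ⊖ E` of the subspace `H_1` need a deeper search.
set_option maxSynthPendingDepth 5

variable {K : Type*} [NormedAddCommGroup K] [InnerProductSpace ℂ K] [CompleteSpace K]
  {R : K →L[ℂ] K}

/-- The part `(1 - θ_n P_M θ_n^*) W` of `W` that is orthogonal to `θ_n M_E`. -/
noncomputable def offTheta (R : K →L[ℂ] K) (n : ℕ) (W : reducedSubspace R →L[ℂ] K) :
    reducedSubspace R →L[ℂ] K :=
  W - thetaIter R n ∘L (cyclicSubspace R).starProjection ∘L
    ContinuousLinearMap.adjoint (thetaIter R n) ∘L W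

theorem offTheta_apply (n : ℕ) (W : reducedSubspace R →L[ℂ] K) (x : reducedSubspace R) :
    offTheta R n W x = W x - thetaIter R n ((cyclicSubspace R).starProjection
      (star (thetaIter R n) (W x))) := rfl

theorem commute_starProjection_cyclicSubspace {a : K →L[ℂ] K} (ha : a ∈ gramAlgebra R) (x : K) :
    (cyclicSubspace R).starProjection (a x) = a ((cyclicSubspace R).starProjection x) := by
  have h1 : ∀ y ∈ (cyclicSubspace R), a y ∈ cyclicSubspace R := apply_mem_cyclicSubspace ha
  have h2 : ∀ y ∈ (cyclicSubspace R)ᗮ, a y ∈ (cyclicSubspace R)ᗮ := by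
    intro y hy
    rw [Submodule.mem_orthogonal] at hy ⊢
    intro u hu
    rw [← ContinuousLinearMap.adjoint_inner_left]
    exact hy _ (apply_mem_cyclicSubspace (star_mem ha) u hu)
  refine ((cyclicSubspace R).eq_starProjection_of_mem_of_inner_eq_zero
    (h1 _ ((cyclicSubspace R).starProjection_apply_mem x)) fun w hw => ?_).symm ▸ rfl
  rw [← map_sub]
  have h3 := h2 _ ((cyclicSubspace R).sub_starProjection_mem_orthogonal x)
  rw [← inner_conj_symm, h3 w hw, map_zero]

theorem isIntertwiner_offTheta (hR : Function.Injective R) (hhalf : IsHalfCentered R) {n : ℕ}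
    {W : reducedSubspace R →L[ℂ] K} (hW : IsIntertwiner R n W) :
    IsIntertwiner R n (offTheta R n W) := by
  obtain ⟨S, hS⟩ := exists_isPolarPair_thetaIter hR hhalf n
  refine ⟨fun x => ?_, fun k x => ?_⟩
  · rw [offTheta_apply]
    exact sub_mem (hW.mem_rangeClosure x) (hS.mem_rangeClosure _)
  · rw [offTheta_apply, offTheta_apply, hW.apply_gramReduced, map_sub, map_sub, ← hS.mul_star_self]
    congr 1
    set θ := thetaIter R n
    change θ ((cyclicSubspace R).starProjection (star θ (θ (star θ (gram R k (W x)))))) =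
      θ ((star θ * gram R k * θ) ((cyclicSubspace R).starProjection (star θ (W x))))
    rw [hS.star_apply_apply, ← commute_starProjection_cyclicSubspace (hS.conj_gram_mem hR k)]
    change _ = θ ((cyclicSubspace R).starProjection (star θ (gram R k (θ (star θ (W x))))))
    rw [hS.apply_star_apply (hW.mem_rangeClosure x)]

theorem inner_theta_offTheta (hR : Function.Injective R) (hhalf : IsHalfCentered R) (n : ℕ)
    (W : reducedSubspace R →L[ℂ] K) :
    ∀ x ∈ cyclicSubspace R, ∀ y, ⟪thetaIter R n x, offTheta R n W y⟫_ℂ = 0 := by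
  obtain ⟨S, hS⟩ := exists_isPolarPair_thetaIter hR hhalf n
  intro x hx y
  rw [offTheta_apply]
  set θ := thetaIter R n
  have e : ⟪θ x, W y - θ ((cyclicSubspace R).starProjection (star θ (W y)))⟫_ℂ =
      ⟪x, star θ (W y - θ ((cyclicSubspace R).starProjection (star θ (W y))))⟫_ℂ :=
    (ContinuousLinearMap.adjoint_inner_right θ _ _).symm
  rw [e, map_sub, hS.star_apply_apply]
  exact (cyclicSubspace R).sub_starProjection_mem_orthogonal _ x hx

/-- The operator `(1 - θ_n P_M θ_n^*) W` can be followed through all `H_j` with `j ≥ n`: at `n`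
its range is orthogonal to `θ_n M_E` by construction, and beyond `n` there are no triples. -/
theorem inner_theta_offTheta_of_le (hR : Function.Injective R) (hhalf : IsHalfCentered R)
    {n : ℕ} (hF : ∀ t ∈ tripleSet R, t.2.2 = n) {W : reducedSubspace R →L[ℂ] K}
    (hW : IsIntertwiner R n W) {j : ℕ} (hj : n ≤ j) :
    ∀ x ∈ cyclicSubspace R, ∀ y, ⟪thetaIter R j x, offTheta R n W y⟫_ℂ = 0 := by
  suffices h : IsIntertwiner R j (offTheta R n W) ∧
      ∀ x ∈ cyclicSubspace R, ∀ y, ⟪thetaIter R j x, offTheta R n W y⟫_ℂ = 0 from h.2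
  induction j, hj using Nat.le_induction with
  | base => exact ⟨isIntertwiner_offTheta hR hhalf hW, inner_theta_offTheta hR hhalf n W⟩
  | succ j hj ih =>
    have hW' := ih.1.succ hR hhalf ih.2
    exact ⟨hW', inner_theta_eq_zero_of_crossOp
      (hW'.crossOp_eq_zero hR hhalf (by omega) fun t ht h => by have := hF t ht; omega)⟩

/-- If `z ∈ H_1` is orthogonal to all `R^j M_E` with `j ≥ 1`, then `z = 0`: the vector `R^* z` is
orthogonal to the dense span of all the `R^j M_E`, so that `z` lies in `E = H_1^⊥`. -/
theorem eq_zero_of_orthogonal_pow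
    (hdense : (⨆ k : ℕ, (cyclicSubspace R).map
      (R ^ k : K →L[ℂ] K).toLinearMap).topologicalClosure = ⊤) {z : K}
    (hz : z ∈ rangeClosure R 1)
    (h : ∀ j, 1 ≤ j → ∀ x ∈ cyclicSubspace R, ⟪(R ^ j) x, z⟫_ℂ = 0) : z = 0 := by
  set w := ContinuousLinearMap.adjoint R z with hw
  have hperp : w ∈ (⨆ k : ℕ, (cyclicSubspace R).map (R ^ k : K →L[ℂ] K).toLinearMap)ᗮ := by
    rw [← Submodule.iInf_orthogonal, Submodule.mem_iInf]
    rintro k _ ⟨x, hx, rfl⟩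
    have e : ⟪(R ^ k) x, w⟫_ℂ = ⟪(R ^ (k + 1)) x, z⟫_ℂ := by
      rw [hw, ContinuousLinearMap.adjoint_inner_right, pow_succ']
      rfl
    exact e.trans (h (k + 1) (by omega) x hx)
  rw [← Submodule.orthogonal_closure, hdense, Submodule.top_orthogonal_eq_bot,
    Submodule.mem_bot] at hperp
  have hker : z ∈ kerAdj R := hperp
  exact inner_self_eq_zero.mp ((mem_rangeClosure_one_iff R z).mp hz z hker)

/-- If all the triples of `F` have the last entry `n`, then `M_E ⊖ E ⊆ θ_n M_E`. -/
theorem exists_theta_eq (hR : Function.Injective R) (hhalf : IsHalfCentered R)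
    (hdense : (⨆ k : ℕ, (cyclicSubspace R).map
      (R ^ k : K →L[ℂ] K).toLinearMap).topologicalClosure = ⊤)
    {n : ℕ} (hn : 1 ≤ n) (hF : ∀ t ∈ tripleSet R, t.2.2 = n) (y : reducedSubspace R) :
    ∃ g ∈ cyclicSubspace R, thetaIter R n g = reducedIncl R y := by
  have hW := isIntertwiner_reducedIncl_of_le hR hhalf hF hn le_rfl
  obtain ⟨S, hS⟩ := exists_isPolarPair_thetaIter hR hhalf n
  refine ⟨(cyclicSubspace R).starProjection (star (thetaIter R n) (reducedIncl R y)),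
    (cyclicSubspace R).starProjection_apply_mem _, ?_⟩
  rw [eq_comm, ← sub_eq_zero, ← offTheta_apply n (reducedIncl R) y]
  refine eq_zero_of_orthogonal_pow hdense
    (rangeClosure_le_of_le R hn ((isIntertwiner_offTheta hR hhalf hW).mem_rangeClosure y)) ?_
  intro j hj
  rcases lt_or_ge j n with hjn | hjn
  · -- For `j < n` both `M_E ⊖ E` and `θ_n M_E`, the closure of `R^n M_E`, are orthogonal
    -- to `R^j M_E`.
    intro x hx
    rw [offTheta_apply, inner_sub_right, inner_pow_apply_eq_zero hR hhalf hF hj hjn hx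
      (reducedIncl_mem_cyclicSubspace R y), zero_sub, neg_eq_zero]
    set θ := thetaIter R n
    have hcl : IsClosed {u | ⟪(R ^ j) x, θ u⟫_ℂ = 0} := isClosed_eq (by fun_prop) (by fun_prop)
    refine hcl.closure_subset_iff.mpr ?_ (mem_closure_image_of_reducing hS.isSelfAdjoint
      (hS.injective hR) (cyclicSubspace R) (apply_mem_cyclicSubspace hS.mem_gramAlgebra)
      ((cyclicSubspace R).starProjection_apply_mem _))
    rintro _ ⟨v, hv, rfl⟩
    change ⟪(R ^ j) x, θ (S v)⟫_ℂ = 0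
    have e : θ (S v) = (R ^ n) v := by rw [hS.pow_eq]; rfl
    rw [e, ← inner_conj_symm, inner_pow_pow_of_le R hjn.le,
      inner_pow_apply_eq_zero hR hhalf hF (by omega) (by omega) hv
        (gram_apply_mem_cyclicSubspace R j x hx), map_zero]
  · exact inner_pow_eq_zero_of_theta hR hhalf fun x hx =>
      inner_theta_offTheta_of_le hR hhalf hF hW hjn x hx y

end Compression

section Eigenvectors

-- The instances on the subspace `M_E ⊖ E` of the subspace `H_1` need a deeper search.
set_option maxSynthPendingDepth 5

variable {K : Type*} [NormedAddCommGroup K] [InnerProductSpace ℂ K] [CompleteSpace K]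
  {R : K →L[ℂ] K}

/-- If `F` consists of a single triple, then the compressions of the `R_k` to `M_E ⊖ E` are
scalars, and the vectors of `M_E` that `θ_n` carries to `M_E ⊖ E` are joint eigenvectors of the
self-adjoint elements of the von Neumann algebra of `R`. -/
theorem scalar_of_tripleSet_eq_singleton (hR : Function.Injective R) (hhalf : IsHalfCentered R)
    (hdense : (⨆ k : ℕ, (cyclicSubspace R).map
      (R ^ k : K →L[ℂ] K).toLinearMap).topologicalClosure = ⊤)
    {lam : restrictedSpectrum (gramAlgebra R) (cyclicSubspace R)}
    {gam : restrictedSpectrum (gramAlgebra (restrictRange R 1)) (reducedSubspace R)} {n : ℕ}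
    (hF : tripleSet R = {(lam, gam, n)}) :
    (∀ k (y : reducedSubspace R), (gramReduced R k).1 y = gam (gramReduced R k) • y) ∧
    ∀ y : reducedSubspace R, ∃ g ∈ cyclicSubspace R, thetaIter R n g = reducedIncl R y ∧
      ∀ a ∈ gramAlgebra R, IsSelfAdjoint a → ∃ c : ℂ, a g = c • g := by
  have hF' : ∀ t ∈ tripleSet R, t.2.2 = n := by
    intro t ht
    rw [hF, Set.mem_singleton_iff] at ht
    rw [ht]
  have hn : 1 ≤ n := by
    have h : (lam, gam, n) ∈ tripleSet R := by rw [hF]; rfl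
    exact h.1
  have hW := isIntertwiner_reducedIncl_of_le hR hhalf hF' hn le_rfl
  have hpre := exists_theta_eq hR hhalf hdense hn hF'
  obtain ⟨S, hS⟩ := exists_isPolarPair_thetaIter hR hhalf n
  set X := crossOp R n (reducedIncl R) with hX
  have hXapp : ∀ (g : cyclicSubspace R) (y : reducedSubspace R),
      thetaIter R n g = reducedIncl R y → X g = y := by
    intro g y h
    refine ext_inner_right ℂ fun v => ?_
    rw [hX, inner_crossOp_left, h, inner_reducedIncl]
  by_cases hX0 : X = 0
  · have hy0 : ∀ y : reducedSubspace R, y = 0 := by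
      intro y
      obtain ⟨g, hg, h⟩ := hpre y
      rw [← hXapp ⟨g, hg⟩ y h, hX0]
      rfl
    refine ⟨fun k y => ?_, fun y => ⟨0, zero_mem _, ?_, fun a _ _ => ⟨0, ?_⟩⟩⟩
    · rw [hy0 y, map_zero, smul_zero]
    · rw [hy0 y, map_zero, map_zero]
    · rw [map_zero, smul_zero]
  obtain ⟨hb, ha⟩ := comp_eq_smul_of_unique_pair _ _
    (restrictedAlgebra_mul_comm hhalf (cyclicSubspace R))
    (restrictedAlgebra_mul_comm (isHalfCentered_restrictRange_one hR hhalf) (reducedSubspace R))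
    X hX0 lam gam (fun lam' gam' h => by
      have h1 := hW.mem_tripleSet hR hhalf hn lam' gam' h
      rw [hF, Set.mem_singleton_iff, Prod.mk.injEq, Prod.mk.injEq] at h1
      exact ⟨h1.1, h1.2.1⟩)
  constructor
  · intro k y
    obtain ⟨g, hg, h⟩ := hpre y
    have h1 := congrArg (fun f => f ⟨g, hg⟩) (hb (gramReduced R k) (isSelfAdjoint_gramReduced R k))
    change (gramReduced R k).1 (X ⟨g, hg⟩) = gam (gramReduced R k) • X ⟨g, hg⟩ at h1
    rwa [hXapp _ y h] at h1
  · intro y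
    obtain ⟨g, hg, h⟩ := hpre y
    refine ⟨g, hg, h, fun a haM hasa => ?_⟩
    obtain ⟨c, hc⟩ : ∃ c : ℂ, X ∘L (restrictOp (gramAlgebra R) (cyclicSubspace R) a haM
        (apply_mem_cyclicSubspace haM)).1 = c • X :=
      ⟨_, ha _ (isSelfAdjoint_restrictOp _ _ _ _ _ hasa)⟩
    refine ⟨(starRingEnd ℂ) c, ?_⟩
    have hXg : ∀ u : cyclicSubspace R, ⟪X u, y⟫_ℂ = ⟪u, (⟨g, hg⟩ : cyclicSubspace R)⟫_ℂ := by
      intro u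
      rw [hX, inner_crossOp_left, ← h]
      have e : ⟪thetaIter R n u, thetaIter R n g⟫_ℂ =
          ⟪(u : K), star (thetaIter R n) (thetaIter R n g)⟫_ℂ :=
        (ContinuousLinearMap.adjoint_inner_right _ _ _).symm
      rw [e, hS.star_apply_apply]
      rfl
    exact congrArg Subtype.val (apply_eq_conj_smul_of_comp_eq_smul X _
      (isSelfAdjoint_restrictOp _ _ _ _ _ hasa) hc hXg)

end Eigenvectors

/-! ### The dimension of `M_E ⊖ E` -/

section OneDimensional

-- The instances on the subspace `M_E ⊖ E` of the subspace `H_1` need a deeper search.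
set_option maxSynthPendingDepth 5

variable {K : Type*} [NormedAddCommGroup K] [InnerProductSpace ℂ K] [CompleteSpace K]
  {R : K →L[ℂ] K}

theorem exists_unit_kerAdj (hdim : Module.finrank ℂ (kerAdj R) = 1) :
    ∃ e ∈ kerAdj R, ‖e‖ = 1 ∧ ∀ x ∈ kerAdj R, x = ⟪e, x⟫_ℂ • e := by
  obtain ⟨v, hv, hspan⟩ := finrank_eq_one_iff'.mp hdim
  have hv0 : (v : K) ≠ 0 := fun h => hv (Subtype.ext h)
  have hn : ‖(v : K)‖ ≠ 0 := norm_ne_zero_iff.mpr hv0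
  refine ⟨((‖(v : K)‖ : ℂ)⁻¹) • (v : K), (kerAdj R).smul_mem _ v.2,
    norm_smul_inv_norm (𝕜 := ℂ) hv0, fun x hx => ?_⟩
  obtain ⟨c, hc⟩ := hspan ⟨x, hx⟩
  have hc' : c • (v : K) = x := congrArg Subtype.val hc
  have hn' : (‖(v : K)‖ : ℂ) ≠ 0 := by exact_mod_cast hn
  rw [← hc', inner_smul_right, inner_smul_left, inner_self_eq_norm_sq_to_K, smul_smul, map_inv₀,
    Complex.conj_ofReal]
  congr 1
  simp only [Complex.coe_algebraMap]
  field_simp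

theorem gram_apply_reducedIncl {e : K} (he : e ∈ kerAdj R)
    (hspan : ∀ x ∈ kerAdj R, x = ⟪e, x⟫_ℂ • e) {γ : ℕ → ℂ}
    (hγ : ∀ k (y : reducedSubspace R), (gramReduced R k).1 y = γ k • y) (k : ℕ)
    (y : reducedSubspace R) :
    gram R k (reducedIncl R y) =
      γ k • reducedIncl R y + ⟪e, gram R k (reducedIncl R y)⟫_ℂ • e := by
  set z := gram R k (reducedIncl R y) with hz
  have h1 : (rangeClosure R 1).starProjection z = γ k • reducedIncl R y := by
    rw [hz, ← (isIntertwiner_reducedIncl R).apply_gramReduced, hγ, map_smul]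
  have h2 := hspan _ (sub_starProjection_mem_kerAdj R z)
  rw [inner_sub_right, (mem_rangeClosure_one_iff R _).mp
    ((rangeClosure R 1).starProjection_apply_mem z) e he, sub_zero, h1] at h2
  rw [← h2]
  abel

/-- If the compressions of the `R_k` to `M_E ⊖ E` are scalars and `dim E = 1`, then
`dim (M_E ⊖ E) ≤ 1`. Indeed, as the `R_k` commute, the functionals `x ↦ ⟪e, R_k x⟫` on `M_E ⊖ E`
are proportional to one another, and a common zero of all of them is a joint eigenvector of the
`R_k` that is orthogonal to `E`. -/
theorem exists_eq_smul_of_scalar (hhalf : IsHalfCentered R) {e : K} (he : e ∈ kerAdj R)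
    (he1 : ‖e‖ = 1) (hspan : ∀ x ∈ kerAdj R, x = ⟪e, x⟫_ℂ • e) {γ : ℕ → ℂ}
    (hγ : ∀ k (y : reducedSubspace R), (gramReduced R k).1 y = γ k • y)
    {f : reducedSubspace R} (hf : f ≠ 0) (y : reducedSubspace R) : ∃ c : ℂ, y = c • f := by
  set ι := reducedIncl R with hι
  set φ : ℕ → reducedSubspace R → ℂ := fun k x => ⟪e, gram R k (ι x)⟫_ℂ with hφ
  have hgram : ∀ k x, gram R k (ι x) = γ k • ι x + φ k x • e :=
    gram_apply_reducedIncl he hspan hγ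
  have hperp : ∀ x, ⟪e, ι x⟫_ℂ = 0 := fun x =>
    (mem_rangeClosure_one_iff R _).mp (reducedIncl_mem_rangeClosure R x) e he
  have hperp' : ∀ x, ⟪ι x, e⟫_ℂ = 0 := fun x => by rw [← inner_conj_symm, hperp, map_zero]
  have hee : ⟪e, e⟫_ℂ = 1 := by rw [inner_self_eq_norm_sq_to_K, he1]; norm_num
  have hzero : ∀ x, (∀ k, φ k x = 0) → x = 0 := by
    intro x hx
    have h1 : ι x = 0 := by
      refine eq_zero_of_joint_eigenvector (reducedIncl_mem_cyclicSubspace R x) ?_ γ fun k => ?_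
      · intro u hu
        rw [hspan u hu, inner_smul_right, hperp', mul_zero]
      · rw [hgram, hx, zero_smul, add_zero]
    exact Subtype.ext (Subtype.ext h1)
  have hreal : ∀ k, (starRingEnd ℂ) (γ k) = γ k := by
    intro k
    have h1 := inner_apply_eq_of_isSelfAdjoint (isSelfAdjoint_gramReduced R k) f f
    rw [hγ, inner_smul_left, inner_smul_right] at h1
    exact mul_right_cancel₀ (inner_self_ne_zero.mpr hf) h1
  have hrel : ∀ j k x v, (starRingEnd ℂ) (φ j v) * φ k x = (starRingEnd ℂ) (φ k v) * φ j x := by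
    intro j k x v
    have h1 : ∀ j k, ⟪gram R j (ι v), gram R k (ι x)⟫_ℂ =
        γ j * (γ k * ⟪ι v, ι x⟫_ℂ) + (starRingEnd ℂ) (φ j v) * φ k x := by
      intro j k
      rw [hgram, hgram, inner_add_left, inner_add_right, inner_add_right]
      simp only [inner_smul_left, inner_smul_right, hperp, hperp', hee, hreal]
      ring
    have h2 : ⟪gram R j (ι v), gram R k (ι x)⟫_ℂ = ⟪gram R k (ι v), gram R j (ι x)⟫_ℂ := by
      rw [inner_apply_eq_of_isSelfAdjoint (isSelfAdjoint_gram R j),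
        inner_apply_eq_of_isSelfAdjoint (isSelfAdjoint_gram R k), ← mul_apply_eq_comp,
        (hhalf j k).eq]
      rfl
    rw [h1, h1] at h2
    linear_combination h2
  obtain ⟨k, hk⟩ : ∃ k, φ k f ≠ 0 := by
    by_contra! h
    exact hf (hzero f h)
  refine ⟨φ k y / φ k f, sub_eq_zero.mp (hzero _ fun j => ?_)⟩
  have hlin : ∀ i, φ i (y - (φ k y / φ k f) • f) = φ i y - (φ k y / φ k f) * φ i f := by
    intro i
    simp only [hφ, map_sub, map_smul, inner_sub_right, inner_smul_right]
  have h1 := hrel j k (y - (φ k y / φ k f) • f) f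
  rw [hlin k, div_mul_cancel₀ _ hk, sub_self, mul_zero] at h1
  exact (mul_eq_zero.mp h1.symm).resolve_left
    ((map_ne_zero _).mpr hk)

theorem exists_unit_reducedSubspace
    (gam : restrictedSpectrum (gramAlgebra (restrictRange R 1)) (reducedSubspace R)) :
    ∃ f : reducedSubspace R, ‖f‖ = 1 := by
  have h : ∃ f : reducedSubspace R, f ≠ 0 := by
    by_contra! h
    have h1 : (1 : restrictedAlgebra (gramAlgebra (restrictRange R 1)) (reducedSubspace R)) =
        0 := by
      refine Subtype.ext ?_
      ext1 x
      rw [h x, map_zero, map_zero]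
    have h2 : gam 1 = 1 := map_one gam
    rw [h1, map_zero] at h2
    exact zero_ne_one h2
  obtain ⟨f, hf⟩ := h
  exact ⟨((‖f‖ : ℂ)⁻¹) • f, norm_smul_inv_norm (𝕜 := ℂ) hf⟩

/-- The structure of `M_E` when `F` is a single triple: `M_E` has an orthonormal basis `e`, `f` with
`e ∈ E`, and it contains a joint unit eigenvector `g` of the `R_k` such that `R ^ n g` is a nonzero
multiple of `f`. -/
theorem exists_eigenvector_of_tripleSet_eq_singleton (hR : Function.Injective R)
    (hhalf : IsHalfCentered R) (hdim : Module.finrank ℂ (kerAdj R) = 1)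
    (hdense : (⨆ k : ℕ, (cyclicSubspace R).map
      (R ^ k : K →L[ℂ] K).toLinearMap).topologicalClosure = ⊤)
    {lam : restrictedSpectrum (gramAlgebra R) (cyclicSubspace R)}
    {gam : restrictedSpectrum (gramAlgebra (restrictRange R 1)) (reducedSubspace R)} {n : ℕ}
    (hF : tripleSet R = {(lam, gam, n)}) :
    ∃ e f g : K, e ∈ kerAdj R ∧ f ∈ cyclicSubspace R ∧ g ∈ cyclicSubspace R ∧
      ‖e‖ = 1 ∧ ‖f‖ = 1 ∧ ‖g‖ = 1 ∧ ⟪e, f⟫_ℂ = 0 ∧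
      (∀ y ∈ cyclicSubspace R, ∃ p q : ℂ, y = p • e + q • f) ∧
      (∀ u ∈ kerAdj R, ∃ c : ℂ, u = c • e) ∧
      (∀ k, ∃ c : ℂ, gram R k g = c • g) ∧ ∃ s : ℂ, s ≠ 0 ∧ (R ^ n) g = s • f := by
  obtain ⟨hγ, hg⟩ := scalar_of_tripleSet_eq_singleton hR hhalf hdense hF
  obtain ⟨e, he, he1, hspan⟩ := exists_unit_kerAdj hdim
  obtain ⟨f, hf1⟩ := exists_unit_reducedSubspace gam
  have hf0 : f ≠ 0 := by
    rintro rfl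
    rw [norm_zero] at hf1
    exact zero_ne_one hf1
  obtain ⟨g, hgM, hgf, hgeig⟩ := hg f
  obtain ⟨S, hS⟩ := exists_isPolarPair_thetaIter hR hhalf n
  have hfn : ‖reducedIncl R f‖ = 1 := hf1
  have hgn : ‖g‖ = 1 := by
    rw [← hfn, ← hgf]
    exact ((ContinuousLinearMap.norm_map_iff_adjoint_comp_self _).mpr hS.star_mul_self g).symm
  refine ⟨e, reducedIncl R f, g, he, reducedIncl_mem_cyclicSubspace R f, hgM, he1, hfn, hgn,
    (mem_rangeClosure_one_iff R _).mp (reducedIncl_mem_rangeClosure R f) e he, fun y hy => ?_,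
    fun u hu => ⟨_, hspan u hu⟩,
    fun k => hgeig _ (gram_mem_gramAlgebra R k) (isSelfAdjoint_gram R k), ?_⟩
  · obtain ⟨v, hv⟩ := exists_reducedIncl_eq (starProjection_apply_mem_cyclicSubspace R hy)
      ((rangeClosure R 1).starProjection_apply_mem y)
    obtain ⟨c, hc⟩ := exists_eq_smul_of_scalar hhalf he he1 hspan hγ hf0 v
    refine ⟨⟪e, y - (rangeClosure R 1).starProjection y⟫_ℂ, c, ?_⟩
    rw [← hspan _ (sub_starProjection_mem_kerAdj R y), ← map_smul, ← hc, hv, sub_add_cancel]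
  · obtain ⟨s, hs⟩ := hgeig S hS.mem_gramAlgebra hS.isSelfAdjoint
    have h1 : (R ^ n) g = s • reducedIncl R f := by
      rw [hS.pow_eq, mul_apply_eq_comp, hs, map_smul, hgf]
    refine ⟨s, ?_, h1⟩
    rintro rfl
    rw [zero_smul] at h1
    have h2 := pow_injective hR n (h1.trans (map_zero _).symm)
    rw [h2, norm_zero] at hgn
    exact zero_ne_one hgn

end OneDimensional

/-! ### The weighted shift -/

section WeightedShift

variable {K : Type*} [NormedAddCommGroup K] [InnerProductSpace ℂ K]

/-- A unit vector in the span of two orthonormal vectors is completed to an orthonormal basis of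
this span. -/
theorem exists_orthonormal_completion {e f g : K} (he : ‖e‖ = 1) (hf : ‖f‖ = 1) (hg : ‖g‖ = 1)
    (hef : ⟪e, f⟫_ℂ = 0) {α β : ℂ} (hgαβ : g = α • e + β • f) :
    ∃ h : K, h = (starRingEnd ℂ) β • e - (starRingEnd ℂ) α • f ∧ ‖h‖ = 1 ∧ ⟪h, g⟫_ℂ = 0 ∧
      ⟪h, f⟫_ℂ = -α ∧ ∀ p q : ℂ, p • e + q • f =
        ⟪g, p • e + q • f⟫_ℂ • g + ⟪h, p • e + q • f⟫_ℂ • h := by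
  have hfe : ⟪f, e⟫_ℂ = 0 := by rw [← inner_conj_symm, hef, map_zero]
  have hee : ⟪e, e⟫_ℂ = 1 := by rw [inner_self_eq_norm_sq_to_K, he]; norm_num
  have hff : ⟪f, f⟫_ℂ = 1 := by rw [inner_self_eq_norm_sq_to_K, hf]; norm_num
  have hgg : ⟪g, g⟫_ℂ = 1 := by rw [inner_self_eq_norm_sq_to_K, hg]; norm_num
  have hαβ : (starRingEnd ℂ) α * α + (starRingEnd ℂ) β * β = 1 := by
    rw [hgαβ] at hgg
    simp only [inner_add_left, inner_add_right, inner_smul_left, inner_smul_right, hee, hff, hef,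
      hfe] at hgg
    linear_combination hgg
  refine ⟨_, rfl, ?_, ?_, ?_, fun p q => ?_⟩
  · have h1 : ⟪(starRingEnd ℂ) β • e - (starRingEnd ℂ) α • f,
        (starRingEnd ℂ) β • e - (starRingEnd ℂ) α • f⟫_ℂ = 1 := by
      simp only [inner_sub_left, inner_sub_right, inner_smul_left, inner_smul_right, hee, hff, hef,
        hfe, Complex.conj_conj]
      linear_combination hαβ
    rw [inner_self_eq_norm_sq_to_K] at h1
    have h2 : ‖(starRingEnd ℂ) β • e - (starRingEnd ℂ) α • f‖ ^ 2 = 1 := by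
      refine Complex.ofReal_injective ?_
      rw [Complex.ofReal_pow, Complex.ofReal_one]
      exact h1
    exact (pow_eq_one_iff_of_nonneg (norm_nonneg _) two_ne_zero).mp h2
  · rw [hgαβ]
    simp only [inner_sub_left, inner_add_right, inner_smul_left, inner_smul_right, hee, hff, hef,
      hfe, Complex.conj_conj]
    ring
  · simp only [inner_sub_left, inner_smul_left, hff, hef, Complex.conj_conj]
    ring
  · rw [hgαβ]
    simp only [inner_sub_left, inner_add_left, inner_add_right, inner_smul_left, inner_smul_right,
      hee, hff, hef, hfe, Complex.conj_conj, smul_add, smul_sub, smul_smul]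
    have e1 : p = ((starRingEnd ℂ) α * p + (starRingEnd ℂ) β * q) * α +
        (β * p - α * q) * (starRingEnd ℂ) β := by linear_combination -p * hαβ
    have e2 : q = ((starRingEnd ℂ) α * p + (starRingEnd ℂ) β * q) * β -
        (β * p - α * q) * (starRingEnd ℂ) α := by linear_combination -q * hαβ
    conv_lhs => rw [e1, e2]
    simp only [mul_one, mul_zero, add_zero, zero_add, sub_zero, zero_sub]
    module

/-- The two orbits `g, R g, …, R^{n-1} g` and `h, R h, R² h, …`, one after the other. -/
def orbitVec (R : K →L[ℂ] K) (n : ℕ) (g h : K) (k : ℕ) : K :=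
  if k < n then (R ^ k) g else (R ^ (k - n)) h

theorem orbitVec_of_lt (R : K →L[ℂ] K) {n : ℕ} (g h : K) {k : ℕ} (hk : k < n) :
    orbitVec R n g h k = (R ^ k) g := if_pos hk

theorem orbitVec_add (R : K →L[ℂ] K) (n : ℕ) (g h : K) (k : ℕ) :
    orbitVec R n g h (n + k) = (R ^ k) h := by
  rw [orbitVec, if_neg (by omega), Nat.add_sub_cancel_left]

theorem apply_orbitVec (R : K →L[ℂ] K) {n : ℕ} (g h : K) {k : ℕ} (hk : k + 1 ≠ n) :
    R (orbitVec R n g h k) = orbitVec R n g h (k + 1) := by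
  rcases lt_or_ge k n with hkn | hkn
  · rw [orbitVec_of_lt R g h hkn, orbitVec_of_lt R g h (by omega : k + 1 < n), pow_succ']
    rfl
  · obtain ⟨i, rfl⟩ := Nat.exists_eq_add_of_le hkn
    rw [orbitVec_add, add_assoc, orbitVec_add, pow_succ']
    rfl

theorem orbitVec_ne_zero {R : K →L[ℂ] K} (hR : Function.Injective R) (n : ℕ) {g h : K}
    (hg : g ≠ 0) (hh : h ≠ 0) (k : ℕ) : orbitVec R n g h k ≠ 0 := by
  have key : ∀ (i : ℕ) (x : K), x ≠ 0 → (R ^ i) x ≠ 0 := fun i x hx h0 =>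
    hx (pow_injective hR i (h0.trans (map_zero _).symm))
  rw [orbitVec]
  split_ifs
  exacts [key _ _ hg, key _ _ hh]

theorem pow_apply_mem_span_orbitVec (R : K →L[ℂ] K) {n : ℕ} (hn : 1 ≤ n) {g h : K} {p q : ℂ}
    (hgn : (R ^ n) g = p • g + q • h) (k : ℕ) :
    (R ^ k) g ∈ Submodule.span ℂ (Set.range (orbitVec R n g h)) := by
  induction k using Nat.strong_induction_on with
  | _ k ih =>
    rcases lt_or_ge k n with hkn | hkn
    · exact Submodule.subset_span ⟨k, orbitVec_of_lt R g h hkn⟩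
    · have e : (R ^ k) g = p • (R ^ (k - n)) g + q • (R ^ (k - n)) h := by
        rw [← map_smul, ← map_smul, ← map_add, ← hgn, ← mul_apply_eq_comp, ← pow_add,
          Nat.sub_add_cancel hkn]
      rw [e]
      refine add_mem (Submodule.smul_mem _ _ (ih _ (by omega))) (Submodule.smul_mem _ _ ?_)
      exact Submodule.subset_span ⟨n + (k - n), orbitVec_add R n g h (k - n)⟩

/-- If the vectors of the two orbits are orthogonal and span a dense subspace, and if `R^n g` is
a combination of `g` and `h`, then `R` is a rank one perturbation of a weighted shift. -/
theorem exists_weightedShift_of_orbits [CompleteSpace K] {R : K →L[ℂ] K}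
    (hR : Function.Injective R) {n : ℕ}
    (hn : 1 ≤ n) {g h : K} (hg : ‖g‖ = 1) (hh : ‖h‖ = 1) {p q : ℂ} (hq : q ≠ 0)
    (hgn : (R ^ n) g = p • g + q • h)
    (horth : ∀ i j, j < i → ⟪orbitVec R n g h i, orbitVec R n g h j⟫_ℂ = 0)
    (hspan : (Submodule.span ℂ (Set.range (orbitVec R n g h))).topologicalClosure = ⊤) :
    ∃ (x : HilbertBasis ℕ ℂ K) (J : K →L[ℂ] K) (a : ℂ), IsWeightedShift x J ∧
      R = J + a • InnerProductSpace.rankOne ℂ (x 0) (x (n - 1)) := by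
  set v := orbitVec R n g h with hv
  have hv0 : ∀ k, v k ≠ 0 := orbitVec_ne_zero hR n
    (norm_ne_zero_iff.mp (by rw [hg]; exact one_ne_zero))
    (norm_ne_zero_iff.mp (by rw [hh]; exact one_ne_zero))
  have hnorm : ∀ k, (‖v k‖ : ℂ) ≠ 0 := fun k => by
    exact_mod_cast norm_ne_zero_iff.mpr (hv0 k)
  set b : ℕ → K := fun k => ((‖v k‖ : ℂ)⁻¹) • v k with hb
  have hvb : ∀ k, v k = (‖v k‖ : ℂ) • b k := fun k => by
    rw [hb, smul_smul, mul_inv_cancel₀ (hnorm k), one_smul]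
  have hbo : Orthonormal ℂ b := by
    refine ⟨fun k => norm_smul_inv_norm (𝕜 := ℂ) (hv0 k), fun i j hij => ?_⟩
    change ⟪((‖v i‖ : ℂ)⁻¹) • v i, ((‖v j‖ : ℂ)⁻¹) • v j⟫_ℂ = 0
    have h0 : ⟪v i, v j⟫_ℂ = 0 := by
      rcases lt_or_gt_of_ne hij with hlt | hlt
      · rw [← inner_conj_symm, horth j i hlt, map_zero]
      · exact horth i j hlt
    rw [inner_smul_left, inner_smul_right, h0, mul_zero, mul_zero]
  have hbspan : ⊤ ≤ (Submodule.span ℂ (Set.range b)).topologicalClosure := by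
    rw [← hspan]
    refine Submodule.topologicalClosure_mono (Submodule.span_le.mpr ?_)
    rintro _ ⟨k, rfl⟩
    rw [hvb k]
    exact Submodule.smul_mem _ _ (Submodule.subset_span ⟨k, rfl⟩)
  set x : HilbertBasis ℕ ℂ K := HilbertBasis.mk hbo hbspan with hx
  have hxb : ∀ k, x k = b k := fun k => congrFun (HilbertBasis.coe_mk hbo hbspan) k
  have hb0 : b 0 = g := by
    have e : v 0 = g := orbitVec_of_lt R g h (by omega)
    simp only [hb, e, hg, Complex.ofReal_one, inv_one, one_smul]
  have hbn : b n = h := by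
    have e : v n = h := orbitVec_add R n g h 0
    simp only [hb, e, hh, Complex.ofReal_one, inv_one, one_smul]
  set c : ℂ := (‖v (n - 1)‖ : ℂ)⁻¹ with hc
  have hbn1 : R (b (n - 1)) = (c * p) • b 0 + (c * q) • b n := by
    have e : v (n - 1) = (R ^ (n - 1)) g := orbitVec_of_lt R g h (by omega)
    have e2 : R ((R ^ (n - 1)) g) = (R ^ n) g := by
      rw [← mul_apply_eq_comp, ← pow_succ', Nat.sub_add_cancel hn]
    rw [hb0, hbn]
    simp only [hb]
    rw [map_smul, e, e2, hgn, ← e, smul_add, smul_smul, smul_smul]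
  refine ⟨x, R - (c * p) • InnerProductSpace.rankOne ℂ (x 0) (x (n - 1)), c * p,
    ⟨fun k => if k + 1 = n then c * q else (‖v k‖ : ℂ)⁻¹ * ‖v (k + 1)‖, fun k => ?_, fun k => ?_⟩,
    (sub_add_cancel _ _).symm⟩
  · beta_reduce
    split_ifs
    · exact mul_ne_zero (inv_ne_zero (hnorm _)) hq
    · exact mul_ne_zero (inv_ne_zero (hnorm _)) (hnorm _)
  · have hinner : ⟪x (n - 1), x k⟫_ℂ = if k + 1 = n then 1 else 0 := by
      rw [orthonormal_iff_ite.mp x.orthonormal]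
      exact if_congr (by omega) rfl rfl
    beta_reduce
    rw [sub_apply, smul_apply, InnerProductSpace.rankOne_apply, hinner]
    split_ifs with hk
    · subst hk
      simp only [Nat.add_sub_cancel] at hbn1 ⊢
      rw [hxb, hxb, hxb, hbn1, one_smul, add_sub_cancel_left]
    · rw [zero_smul, smul_zero, sub_zero, hxb, hxb]
      have e : R (b k) = ((‖v k‖ : ℂ)⁻¹) • v (k + 1) := by
        rw [hb, map_smul, hv, apply_orbitVec R g h hk]
      conv_lhs => rw [e, hvb (k + 1), smul_smul]

end WeightedShift

section Orthogonality

variable {K : Type*} [NormedAddCommGroup K] [InnerProductSpace ℂ K] [CompleteSpace K]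

/-- The orbits of two orthogonal joint eigenvectors `g` and `h` of the `R_k` are orthogonal, if
`R^k g ⊥ g, h` for `0 < k < n` and `R^k h ⊥ g, h` for all `k > 0`. -/
theorem inner_orbitVec_eq_zero {R : K →L[ℂ] K} {n : ℕ} {g h : K} (hgh : ⟪h, g⟫_ℂ = 0)
    (hg : ∀ k, ∃ c : ℂ, gram R k g = c • g) (hh : ∀ k, ∃ c : ℂ, gram R k h = c • h)
    (h1 : ∀ k, 1 ≤ k → k < n → ⟪(R ^ k) g, g⟫_ℂ = 0 ∧ ⟪(R ^ k) g, h⟫_ℂ = 0)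
    (h2 : ∀ k, 1 ≤ k → ⟪(R ^ k) h, g⟫_ℂ = 0 ∧ ⟪(R ^ k) h, h⟫_ℂ = 0) {i j : ℕ} (hij : j < i) :
    ⟪orbitVec R n g h i, orbitVec R n g h j⟫_ℂ = 0 := by
  have key : ∀ {i j : ℕ} {x y : K}, (∃ c : ℂ, gram R j y = c • y) → j ≤ i →
      ⟪(R ^ (i - j)) x, y⟫_ℂ = 0 → ⟪(R ^ i) x, (R ^ j) y⟫_ℂ = 0 := by
    rintro i j x y ⟨c, hc⟩ hle h0
    rw [inner_pow_pow_of_le R hle, hc, inner_smul_right, h0, mul_zero]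
  rcases lt_or_ge i n with hi | hi
  · rw [orbitVec_of_lt R g h hi, orbitVec_of_lt R g h (hij.trans hi)]
    exact key (hg j) hij.le (h1 _ (by omega) (by omega)).1
  obtain ⟨i, rfl⟩ := Nat.exists_eq_add_of_le hi
  rw [orbitVec_add]
  rcases lt_or_ge j n with hj | hj
  · rw [orbitVec_of_lt R g h hj]
    rcases lt_trichotomy i j with hlt | rfl | hlt
    · rw [← inner_conj_symm, key (hh i) hlt.le (h1 _ (by omega) (by omega)).2, map_zero]
    · refine key (hg i) le_rfl ?_
      rw [Nat.sub_self]
      exact hgh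
    · exact key (hg j) hlt.le (h2 _ (by omega)).1
  · obtain ⟨j, rfl⟩ := Nat.exists_eq_add_of_le hj
    rw [orbitVec_add]
    exact key (hh j) (by omega) (h2 _ (by omega)).2

end Orthogonality

end HalfCentered

theorem mainTheorem3 {H : Type*} [NormedAddCommGroup H] [InnerProductSpace ℂ H] [CompleteSpace H]
    (T : H →L[ℂ] H) (hinj : Function.Injective T) (hhalf : HalfCentered.IsHalfCentered T)
    (hdim : Module.finrank ℂ (HalfCentered.kerAdj T) = 1)
    (hdense : (⨆ k : ℕ, (HalfCentered.cyclicSubspace T).map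
      (T ^ k : H →L[ℂ] H).toLinearMap).topologicalClosure = ⊤)
    (lam : HalfCentered.restrictedSpectrum (HalfCentered.gramAlgebra T)
      (HalfCentered.cyclicSubspace T))
    (gam : HalfCentered.restrictedSpectrum
      (HalfCentered.gramAlgebra (HalfCentered.restrictRange T 1)) (HalfCentered.reducedSubspace T))
    (n : ℕ) (hF : HalfCentered.tripleSet T = {(lam, gam, n)}) :
    ∃ (x : HilbertBasis ℕ ℂ H) (J : H →L[ℂ] H) (a : ℂ),
      HalfCentered.IsWeightedShift x J ∧
      T = J + a • InnerProductSpace.rankOne ℂ (x 0) (x (n - 1)) := by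
  have hF' : ∀ t ∈ HalfCentered.tripleSet T, t.2.2 = n := by
    intro t ht
    rw [hF, Set.mem_singleton_iff] at ht
    rw [ht]
  have hn : 1 ≤ n := by
    have h : (lam, gam, n) ∈ HalfCentered.tripleSet T := by rw [hF]; rfl
    exact h.1
  obtain ⟨e, f, g, he, hf, hg, he1, hf1, hg1, hef, hM, hE, hgeig, s, hs, hgn⟩ :=
    HalfCentered.exists_eigenvector_of_tripleSet_eq_singleton hinj hhalf hdim hdense hF
  obtain ⟨α, β, hαβ⟩ := hM g hg
  obtain ⟨h, hhdef, hh1, hhg, hhf, hexp⟩ :=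
    HalfCentered.exists_orthonormal_completion he1 hf1 hg1 hef hαβ
  have hh : h ∈ HalfCentered.cyclicSubspace T := by
    rw [hhdef]
    exact sub_mem (Submodule.smul_mem _ _ (HalfCentered.kerAdj_le_cyclicSubspace T he))
      (Submodule.smul_mem _ _ hf)
  have hexp' : ∀ y ∈ HalfCentered.cyclicSubspace T, y = ⟪g, y⟫_ℂ • g + ⟪h, y⟫_ℂ • h := by
    intro y hy
    obtain ⟨p, q, rfl⟩ := hM y hy
    exact hexp p q
  have hgh : ⟪g, h⟫_ℂ = 0 := by rw [← inner_conj_symm, hhg, map_zero]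
  have hheig : ∀ k, ∃ c : ℂ, HalfCentered.gram T k h = c • h := by
    intro k
    refine ⟨⟪h, HalfCentered.gram T k h⟫_ℂ, ?_⟩
    obtain ⟨c, hc⟩ := hgeig k
    have h0 : ⟪g, HalfCentered.gram T k h⟫_ℂ = 0 := by
      rw [← HalfCentered.inner_apply_eq_of_isSelfAdjoint (HalfCentered.isSelfAdjoint_gram T k), hc,
        inner_smul_left, hgh, mul_zero]
    conv_lhs => rw [hexp' _ (HalfCentered.gram_apply_mem_cyclicSubspace T k h hh), h0, zero_smul,
      zero_add]
  -- If `α = 0`, then `g` is a joint eigenvector orthogonal to `E`.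
  have hα : α ≠ 0 := by
    rintro rfl
    rw [zero_smul, zero_add] at hαβ
    choose c hc using hgeig
    have h0 := HalfCentered.eq_zero_of_joint_eigenvector hg (fun u hu => by
      obtain ⟨d, rfl⟩ := hE u hu
      rw [hαβ, inner_smul_left, inner_smul_right, ← inner_conj_symm, hef, map_zero, mul_zero,
        mul_zero]) c hc
    rw [h0, norm_zero] at hg1
    exact zero_ne_one hg1
  have h1 : ∀ k, 1 ≤ k → k < n → ∀ y ∈ HalfCentered.cyclicSubspace T,
      ∀ z ∈ HalfCentered.cyclicSubspace T, ⟪(T ^ k) y, z⟫_ℂ = 0 := fun k hk hkn y hy z hz =>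
    HalfCentered.inner_pow_apply_eq_zero hinj hhalf hF' hk hkn hy hz
  have hTe : ∀ k, 1 ≤ k → ∀ y, ⟪(T ^ k) y, e⟫_ℂ = 0 := by
    intro k hk y
    obtain ⟨i, rfl⟩ := Nat.exists_eq_succ_of_ne_zero (show k ≠ 0 by omega)
    exact HalfCentered.inner_pow_succ_eq_zero_of_mem_kerAdj he i y
  have h2 : ∀ k, 1 ≤ k → ⟪(T ^ k) h, f⟫_ℂ = 0 := by
    intro k
    induction k using Nat.strong_induction_on with
    | _ k ih =>
      intro hk
      rcases lt_or_ge k n with hkn | hkn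
      · exact h1 k hk hkn h hh f hf
      · -- Here `f` is replaced by a multiple of `T ^ n g`, and `g` by `α e + β f`.
        obtain ⟨c, hc⟩ := hgeig n
        have h0 : ⟪(T ^ (k - n)) h, g⟫_ℂ = 0 := by
          rcases Nat.eq_zero_or_pos (k - n) with h0 | h0
          · rw [h0]
            exact hhg
          · rw [hαβ, inner_add_right, inner_smul_right, inner_smul_right, hTe _ h0,
              ih _ (by omega) h0, mul_zero, mul_zero, add_zero]
        have h3 : ⟪(T ^ k) h, (T ^ n) g⟫_ℂ = 0 := by
          rw [HalfCentered.inner_pow_pow_of_le T hkn, hc, inner_smul_right, h0, mul_zero]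
        rw [hgn, inner_smul_right] at h3
        exact (mul_eq_zero.mp h3).resolve_left hs
  have h3 : ∀ k, 1 ≤ k → ∀ y ∈ HalfCentered.cyclicSubspace T, ⟪(T ^ k) h, y⟫_ℂ = 0 := by
    intro k hk y hy
    obtain ⟨p, q, rfl⟩ := hM y hy
    rw [inner_add_right, inner_smul_right, inner_smul_right, hTe k hk, h2 k hk, mul_zero, mul_zero,
      add_zero]
  have hgn' : (T ^ n) g = (s * ⟪g, f⟫_ℂ) • g + (s * -α) • h := by
    rw [hgn, mul_smul, mul_smul, ← smul_add, ← hhf, ← hexp' f hf]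
  refine HalfCentered.exists_weightedShift_of_orbits hinj hn hg1 hh1
    (mul_ne_zero hs (neg_ne_zero.mpr hα)) hgn' (fun i j hij =>
      HalfCentered.inner_orbitVec_eq_zero hhg hgeig hheig
        (fun k hk hkn => ⟨h1 k hk hkn g hg g hg, h1 k hk hkn g hg h hh⟩)
        (fun k hk => ⟨h3 k hk g hg, h3 k hk h hh⟩) hij) ?_
  rw [eq_top_iff, ← hdense]
  refine Submodule.topologicalClosure_mono (iSup_le fun k => ?_)
  rintro _ ⟨y, hy, rfl⟩
  change (T ^ k) y ∈ _
  rw [hexp' y hy, map_add, map_smul, map_smul]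
  refine add_mem (Submodule.smul_mem _ _
    (HalfCentered.pow_apply_mem_span_orbitVec T hn hgn' k)) (Submodule.smul_mem _ _ ?_)
  exact Submodule.subset_span ⟨n + k, HalfCentered.orbitVec_add T n g h k⟩
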